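/- Let $P\subset\mathbf R^3$ be a convex polyhedron, i.e. the boundary of the convex hull $K$ of a finite set of points that do not all lie in one plane, oriented by its outward normals. Let $h(x,y,z)=z$, and assume that $h$ attains its maximum and its minimum on $P$ at unique points, the top and the bottom vertex of $P$. For $\lambda>0$ let $X^\lambda$ denote the image of $X$ under $(x,y,z)\mapsto(x/\lambda,y/\lambda,z)$. A path $\Gamma=[\gamma_0,\dots,\gamma_k]$ in $P$ is a sequence of points, successive ones being distinct, such that every edge $\gamma_i\gamma_{i+1}$ lies in $P$; it is monotone if $h(\gamma_0),\dots,h(\gamma_k)$ is strictly monotone. Its left angle at an interior vertex is $\theta_i=\angle(\gamma_{i-1},\gamma_i,\gamma_{i+1})$ and its right angle is $\theta_i'=\angle(\gamma_{i+1},\gamma_i,\gamma_{i-1})$. Here $\angle(a,o,b)$ is the length of the arc of the link of $o$ (the closed curve formed by the unit vectors that point from $o$ to the other points of the faces containing $o$) that leads, counterclockwise as seen from outside $P$, from the direction of $b$ to that of $a$; if the two directions agree, it is the length of the whole link. Angles of paths in $\mathbf R^2$ are defined likewise, with values in $(0,2\pi]$. A path $[\overline\gamma_0,\dots,\overline\gamma_m]$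 in $\mathbf R^2$ is a mixed development based at $\gamma_\ell$ of a path $[\gamma_0,\dots,\gamma_m]$ in $P$ if corresponding edges have equal lengths, corresponding right angles are equal at the interior vertices with index $i\le\ell$, and corresponding left angles are equal at those with $i>\ell$. Let $\Gamma=[\gamma_0,\dots,\gamma_k]$ be a monotone path in $P$ such that $\gamma_k$ is a vertex of $P$ other than its top and bottom vertex, and let $0\le\ell<k$. Let $D\Gamma=[\gamma_0,\dots,\gamma_{k-1},\gamma_k,\gamma_{k-1},\dots,\gamma_0]=:[\gamma_0,\dots,\gamma_{2k}]$ be the doubling of $\Gamma$, and let $\overline{D\Gamma^\lambda}=[\overline\gamma_0^\lambda,\dots,\overline\gamma_{2k}^\lambda]$ be a mixed development based at $\gamma_\ell^\lambda$ of the path $D\Gamma^\lambda$ in $P^\lambda$. Then for all sufficiently large $\lambda$: 1. $\overline{D\Gamma^\lambda}$ is simple, i.e. only consecutive edges intersect, and these only at their common vertex. 2. $\overline\gamma_0^\lambda\ne\overline\gamma_{2k}^\lambda$, and the line through these two points meets $\overline{D\Gamma^\lambda}$ at no other point. 3. If $\alpha_0^\lambda,\beta_0^\lambda$ denote the interior angles,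 at $\overline\gamma_0^\lambda$ and $\overline\gamma_{2k}^\lambda$, of the closed path obtained by adding the edge $\overline\gamma_{2k}^\lambda\overline\gamma_0^\lambda$ to $\overline{D\Gamma^\lambda}$, then $\alpha_0^\lambda+\beta_0^\lambda<\pi$. Furthermore, $\alpha_0^\lambda\to\pi/2$ and $\beta_0^\lambda\to\pi/2$ as $\lambda\to\infty$. -/

import Mathlib

namespace StretchedPaths

/-- Euclidean three-space. The Euclidean plane is represented by the complex numbers. -/
abbrev E3 : Type := EuclideanSpace ℝ (Fin 3)

/-- The height of a point. -/
def height (x : E3) : ℝ := x 2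

/-- The solid spanned by a finite set of points. -/
def body (V : Finset E3) : Set E3 := convexHull ℝ (V : Set E3)

/-- The convex polyhedron (a surface) spanned by a finite set of points. -/
def surface (V : Finset E3) : Set E3 := frontier (body V)

/-- `v` is a vertex of the polyhedron. -/
def IsVertex (V : Finset E3) (v : E3) : Prop := v ∈ (body V).extremePoints ℝ

/-- `t` is the unique highest point of the polyhedron. -/
def IsTop (V : Finset E3) (t : E3) : Prop :=
  t ∈ surface V ∧ ∀ x ∈ surface V, x ≠ t → height x < height t

/-- `b` is the unique lowest point of the polyhedron. -/
def IsBottom (V : Finset E3) (b : E3) : Prop :=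
  b ∈ surface V ∧ ∀ x ∈ surface V, x ≠ b → height b < height x

/-- The normalized affine stretching `(x, y, z) ↦ (x / s, y / s, z)`. -/
noncomputable def stretch (s : ℝ) (x : E3) : E3 := !₂[x 0 / s, x 1 / s, x 2]

open Classical in
/-- The points spanning the stretched polyhedron. -/
noncomputable def stretchPoints (s : ℝ) (V : Finset E3) : Finset E3 := V.image (stretch s)

/-! ### Angles in the polyhedron -/

/-- The star of `o`: the union of the faces that contain `o`. As the surface bounds a convex
body, a point shares a face with `o` exactly if the segment joining it to `o` lies in the
surface. -/
def star (V : Finset E3) (o : E3) : Set E3 := {x | segment ℝ o x ⊆ surface V}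

/-- The determinant of three vectors. -/
def det3 (a b c : E3) : ℝ :=
  Matrix.det !![a 0, a 1, a 2; b 0, b 1, b 2; c 0, c 1, c 2]

/-- For `w ≠ 0`, let `b'`, `x'` be the projections of `b`, `x` to the plane orthogonal to `w`.
This is the complex number of modulus `‖w‖ ^ 2 * ‖b'‖ * ‖x'‖` whose argument is the angle by
which `b'` has to be turned to point in the direction of `x'`, counterclockwise for an observer
towards whom the vector `-w` points. -/
noncomputable def rotation (w b x : E3) : ℂ :=
  ⟨inner ℝ b x * ‖w‖ ^ 2 - inner ℝ b w * inner ℝ x w, ‖w‖ * det3 b x (-w)⟩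

/-- The angle by which the ray from `o` through `b` has to be turned around the axis from `o` to
an interior point of the polyhedron (the centroid of the spanning points), counterclockwise as
seen from outside, to reach the half-plane containing `x`. A half-plane bounded by this axis
contains exactly one ray from `o` tangent to the surface, so this is a coordinate on the link
of `o`, compatible with the orientation of the surface by outward normals. -/
noncomputable def azimuth (V : Finset E3) (o b x : E3) : ℂ :=
  rotation (V.centroid ℝ id - o) (b - o) (x - o)

/-- The representative of an argument in `[0, 2π)`. -/
noncomputable def argIco (z : ℂ) : ℝ := toIcoMod Real.two_pi_pos 0 z.arg

/-- The representative of an argument in `(0, 2π]`. -/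
noncomputable def argIoc (z : ℂ) : ℝ := toIocMod Real.two_pi_pos 0 z.arg

/-- The (left) angle of the path `[a, o, b]` in the polyhedron, for `a`, `b` in the star of `o`
and different from `o`: the length of the arc of the link of `o` (a closed curve in the unit
sphere around `o`) that leads, counterclockwise as seen from outside, from the direction of `b`
to the direction of `a`; it is the whole link if the two directions agree.
The length of a curve in the sphere is the supremum of the lengths of the inscribed chains of
great-circle arcs; here the chain is given by the directions of `x 0 = b, x 1, …, x n, a`. -/
noncomputable def surfaceAngle (V : Finset E3) (a o b : E3) : ℝ :=
  sSup {L : ℝ | ∃ (n : ℕ) (x : ℕ → E3),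
    x 0 = b ∧
    (∀ j ≤ n, x j ∈ star V o ∧ x j ≠ o) ∧
    (∀ j < n, argIco (azimuth V o b (x j)) ≤ argIco (azimuth V o b (x (j + 1)))) ∧
    argIco (azimuth V o b (x n)) ≤ argIoc (azimuth V o b a) ∧
    L = ∑ j ∈ Finset.range n, EuclideanGeometry.angle (x j) o (x (j + 1))
      + EuclideanGeometry.angle (x n) o a}

/-- The (left) angle of the path `[a, o, b]` in the plane, in `(0, 2π]`: the counterclockwise
angle from the direction of `b` to the direction of `a`. -/
noncomputable def planeAngle (a o b : ℂ) : ℝ := argIoc ((a - o) / (b - o))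

/-! ### Paths, doublings, mixed developments

A path with `k` edges is given by its vertices `γ 0, …, γ k`; the values `γ i` for `i > k` play
no role. -/

/-- `[γ 0, …, γ k]` is a path in the polyhedron. -/
def IsPathIn (V : Finset E3) (k : ℕ) (γ : ℕ → E3) : Prop :=
  ∀ i < k, γ i ≠ γ (i + 1) ∧ segment ℝ (γ i) (γ (i + 1)) ⊆ surface V

/-- The heights of the vertices form a strictly monotone sequence. -/
def IsMonotonePath (k : ℕ) (γ : ℕ → E3) : Prop :=
  (∀ i < k, height (γ i) < height (γ (i + 1))) ∨ (∀ i < k, height (γ (i + 1)) < height (γ i))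

/-- The doubling `[γ 0, …, γ (k - 1), γ k, γ (k - 1), …, γ 0]`, a path with `2 * k` edges. -/
def doubling (k : ℕ) (γ : ℕ → E3) (i : ℕ) : E3 := if i ≤ k then γ i else γ (2 * k - i)

/-- `[g 0, …, g m]` is a mixed development, based at the vertex number `l`, of the path
`[δ 0, …, δ m]` in the polyhedron: edges keep their lengths, right angles are kept at the
interior vertices up to number `l`, and left angles are kept at the later ones. For `l = 0` this
is a (left) development. -/
def IsMixedDevelopment (V : Finset E3) (m : ℕ) (δ : ℕ → E3) (l : ℕ) (g : ℕ → ℂ) : Prop :=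
  (∀ i < m, dist (g i) (g (i + 1)) = dist (δ i) (δ (i + 1))) ∧
  (∀ i, i + 1 < m → i + 1 ≤ l →
    planeAngle (g (i + 2)) (g (i + 1)) (g i)
      = surfaceAngle V (δ (i + 2)) (δ (i + 1)) (δ i)) ∧
  (∀ i, i + 1 < m → l < i + 1 →
    planeAngle (g i) (g (i + 1)) (g (i + 2))
      = surfaceAngle V (δ i) (δ (i + 1)) (δ (i + 2)))

/-- `g` is a mixed development of the doubling of `γ`, stretched by `s`, in the stretched
polyhedron. -/
def IsDevelopmentOfStretchedDoubling (V : Finset E3) (k : ℕ) (γ : ℕ → E3) (l : ℕ) (s : ℝ)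
    (g : ℕ → ℂ) : Prop :=
  IsMixedDevelopment (stretchPoints s V) (2 * k) (fun i => stretch s (doubling k γ i)) l g

/-! ### Plane paths -/

/-- The union of the edges of the path `[g 0, …, g m]`. -/
def trace (m : ℕ) (g : ℕ → ℂ) : Set ℂ := ⋃ i < m, segment ℝ (g i) (g (i + 1))

/-- Only consecutive edges intersect, and do so only at their common vertex. -/
def IsSimplePath (m : ℕ) (g : ℕ → ℂ) : Prop :=
  (∀ i, i + 1 < m →
    segment ℝ (g i) (g (i + 1)) ∩ segment ℝ (g (i + 1)) (g (i + 2)) = {g (i + 1)}) ∧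
  (∀ i j, i + 1 < j → j < m →
    Disjoint (segment ℝ (g i) (g (i + 1))) (segment ℝ (g j) (g (j + 1))))

/-- The points enclosed by a plane curve: the union of the bounded components of its
complement. -/
def inside (C : Set ℂ) : Set ℂ :=
  {x | x ∈ Cᶜ ∧ Bornology.IsBounded (connectedComponentIn Cᶜ x)}

open Classical in
/-- The interior angle of a simple closed polygonal path with trace `C` at its vertex `v`, where
`p` is the vertex before `v` and `q` the vertex after `v`. It is the left angle of `[p, v, q]` if
the points near `v` that lie strictly to the left of `[p, v, q]` are enclosed by the path, and
the right angle otherwise. -/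
noncomputable def interiorAngle (C : Set ℂ) (p v q : ℂ) : ℝ :=
  if ∀ᶠ x in nhdsWithin v {v}ᶜ, planeAngle p v x < planeAngle p v q → x ∈ inside C then
    planeAngle p v q
  else planeAngle q v p

/-- The trace of the closed path `[g 0, …, g m, g 0]`. -/
def closedTrace (m : ℕ) (g : ℕ → ℂ) : Set ℂ := trace m g ∪ segment ℝ (g m) (g 0)

/-- The interior angle of the closed path `[g 0, …, g m, g 0]` at `g 0`. -/
noncomputable def startAngle (m : ℕ) (g : ℕ → ℂ) : ℝ :=
  interiorAngle (closedTrace m g) (g m) (g 0) (g 1)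

/-- The interior angle of the closed path `[g 0, …, g m, g 0]` at `g m`. -/
noncomputable def endAngle (m : ℕ) (g : ℕ → ℂ) : ℝ :=
  interiorAngle (closedTrace m g) (g (m - 1)) (g m) (g 0)

end StretchedPaths

/-! As `λ` grows, every non-horizontal edge direction becomes vertical. At an interior vertex of `Γ`
one neighbour is above and the other below, so the angle in space between the two directions tends
to `π`. Each of the two surface angles is at least this angle, and their sum is at most `2π` by
convexity, so both tend to `π`. At `γ_k` some segment of the surface leaves on the other side in
height, since `γ_k` is neither top nor bottom. Going there and back inside the link shows that the
total angle tends to `2π`, yet it stays below `2π` because `γ_k` is a vertex.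

The bounds by `2π` come from integral geometry. The angle between two vectors is at most a constant
times the measure of the planes through the origin that separate them
(`angle_le_volume_separating`). A plane through the apex of a convex cone changes sides at most
twice along a closed chain of rays in its boundary (`not_alternating`), so integrating over all
planes bounds the chain by `2π` (`sum_angle_le`, `sum_angle_star_le`). At a vertex an open set of
supporting planes never changes sides, which makes the bound strict (`surfaceAngle_self_bounds`).

In the development, the edges on the way out thus have small arguments `φ i` relative to the first
edge. The turn at the tip falls short of a full reversal by the positive curvature there. On the way
back, the turn at each earlier vertex either cancels the turn made on the way out (index at most
`l`) or adds up with it to `2π` minus the sum of the two angles, which is nonnegative. So the edge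
opposite to edge `i` is its reverse, rotated by a small `δ i > 0` (`exists_polar_of_turns`,
`eventually_exists_polar`).

Consequently the sum of two opposite edges points almost exactly to the right of the path. Such a
hairpin is simple and lies above its base line; two linear functions, `re ± im`, suffice to see this
(`IsHairpin`). The base edge is the sum of all these right-pointing vectors, hence nearly
perpendicular to the first and last edges, and its exact direction cancels in the sum of the two
base angles, which is `π - δ 0` (`angles_of_polar`). -/

namespace StretchedPaths

/-! ### Measuring angles by separating planes -/

open MeasureTheory

/-- The vectors of the unit ball whose orthogonal plane strictly separates `u` from `v`. -/
def separating (u v : E3) : Set E3 :=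
  {n | n ∈ Metric.ball (0 : E3) 1 ∧ inner ℝ n u * inner ℝ n v < 0}

lemma isOpen_separating (u v : E3) : IsOpen (separating u v) := by
  have h : IsOpen {n : E3 | inner ℝ n u * inner ℝ n v < 0} :=
    isOpen_lt (by fun_prop) continuous_const
  exact Metric.isOpen_ball.inter h

lemma measurableSet_separating (u v : E3) : MeasurableSet (separating u v) :=
  (isOpen_separating u v).measurableSet

lemma separating_subset_ball (u v : E3) : separating u v ⊆ Metric.ball 0 1 := fun _ h => h.1

lemma separating_comm (u v : E3) : separating u v = separating v u := by
  ext n; simp only [separating, Set.mem_ofPred_eq, mul_comm]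

lemma separating_smul {a b : ℝ} (ha : 0 < a) (hb : 0 < b) (u v : E3) :
    separating (a • u) (b • v) = separating u v := by
  ext n
  simp only [separating, Set.mem_ofPred_eq, inner_smul_right]
  have h : a * inner ℝ n u * (b * inner ℝ n v) = (a * b) * (inner ℝ n u * inner ℝ n v) := by ring
  rw [h, mul_neg_iff]
  have hab : 0 < a * b := by positivity
  simp [hab, not_lt.2 hab.le]

lemma volume_separating_isometry (R : E3 ≃ₗᵢ[ℝ] E3) (u v : E3) :
    volume.real (separating (R u) (R v)) = volume.real (separating u v) := by
  have h : R ⁻¹' separating (R u) (R v) = separating u v := by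
    ext n
    simp [separating]
  rw [← h, measureReal_def, measureReal_def,
    R.measurePreserving.measure_preimage (measurableSet_separating _ _).nullMeasurableSet]

/-- The volume of the unit ball. -/
noncomputable def ballVolume : ℝ := volume.real (Metric.ball (0 : E3) 1)

lemma ballVolume_pos : 0 < ballVolume := by
  refine ENNReal.toReal_pos ?_ ?_
  · exact (Metric.measure_ball_pos _ _ one_pos).ne'
  · exact measure_ball_lt_top.ne

lemma volume_separating_ne_top (u v : E3) : volume (separating u v) ≠ ⊤ :=
  ((measure_mono (separating_subset_ball u v)).trans_lt measure_ball_lt_top).ne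

lemma volume_orthogonal {u : E3} (hu : u ≠ 0) : volume {n : E3 | inner ℝ n u = 0} = 0 := by
  have h : {n : E3 | inner ℝ n u = 0} = ((ℝ ∙ u)ᗮ : Submodule ℝ E3) := by
    ext n
    simp [Submodule.mem_orthogonal_singleton_iff_inner_left]
  rw [h]
  refine Measure.addHaar_submodule _ _ fun htop => hu ?_
  have : u ∈ (ℝ ∙ u)ᗮ := htop ▸ Submodule.mem_top
  rwa [Submodule.mem_orthogonal_singleton_iff_inner_left, inner_self_eq_zero] at this

/-- A plane that separates `u` from `w` and misses `v` separates `v` from one of them; the normals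
of the planes through `v` form a null set. -/
lemma volume_separating_triangle (u v w : E3) (hv : v ≠ 0) :
    volume.real (separating u w) ≤
      volume.real (separating u v) + volume.real (separating v w) := by
  have hsub : separating u w ⊆
      (separating u v ∪ separating v w) ∪ {n : E3 | inner ℝ n v = 0} := by
    rintro n ⟨hn, h⟩
    by_contra hc
    simp only [separating, Set.mem_union, Set.mem_ofPred_eq, hn, true_and, not_or, not_lt] at hc
    obtain ⟨⟨h1, h2⟩, h3⟩ := hc
    have h4 : 0 < inner ℝ n v * inner ℝ n v := mul_self_pos.2 h3
    have := mul_nonneg h1 h2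
    nlinarith
  have h1 : volume.real (separating u w) ≤ volume.real
      ((separating u v ∪ separating v w) ∪ {n : E3 | inner ℝ n v = 0}) := by
    refine measureReal_mono hsub ?_
    refine measure_union_ne_top (measure_union_ne_top ?_ ?_) ?_
    · exact volume_separating_ne_top _ _
    · exact volume_separating_ne_top _ _
    · rw [volume_orthogonal hv]; exact ENNReal.zero_ne_top
  have h2 := measureReal_union_le (μ := volume) (separating u v ∪ separating v w)
    {n : E3 | inner ℝ n v = 0}
  have h3 := measureReal_union_le (μ := volume) (separating u v) (separating v w)
  have h4 : volume.real {n : E3 | inner ℝ n v = 0} = 0 := by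
    rw [measureReal_def, volume_orthogonal hv]; rfl
  linarith

lemma volume_separating_neg {u : E3} (hu : u ≠ 0) :
    volume.real (separating u (-u)) = ballVolume := by
  refine le_antisymm (measureReal_mono (separating_subset_ball _ _) measure_ball_lt_top.ne) ?_
  have hsub : Metric.ball (0 : E3) 1 ⊆ separating u (-u) ∪ {n : E3 | inner ℝ n u = 0} := by
    intro n hn
    by_cases h : inner ℝ n u = 0
    · exact Or.inr h
    · refine Or.inl ⟨hn, ?_⟩
      rw [inner_neg_right]
      have : 0 < inner ℝ n u * inner ℝ n u := mul_self_pos.2 h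
      linarith
  have h1 : ballVolume ≤ volume.real (separating u (-u) ∪ {n : E3 | inner ℝ n u = 0}) := by
    refine measureReal_mono hsub (measure_union_ne_top (volume_separating_ne_top _ _) ?_)
    rw [volume_orthogonal hu]; exact ENNReal.zero_ne_top
  have h2 := measureReal_union_le (μ := volume) (separating u (-u)) {n : E3 | inner ℝ n u = 0}
  have h4 : volume.real {n : E3 | inner ℝ n u = 0} = 0 := by
    rw [measureReal_def, volume_orthogonal hu]; rfl
  linarith

/-- The point with angular coordinate `t` on the great circle through `u` and `v`. -/
noncomputable def circlePoint (u v : E3) (t : ℝ) : E3 := Real.cos t • u + Real.sin t • v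

/-! ### Separating planes for points of a great circle -/

section Circle

variable {u v : E3}

lemma inner_circlePoint (hu : ‖u‖ = 1) (hv : ‖v‖ = 1) (huv : inner ℝ u v = 0) (s t : ℝ) :
    inner ℝ (circlePoint u v s) (circlePoint u v t) = Real.cos (t - s) := by
  have hvu : inner ℝ v u = 0 := by rw [real_inner_comm, huv]
  simp only [circlePoint, inner_add_left, inner_add_right, inner_smul_left, inner_smul_right,
    huv, hvu, real_inner_self_eq_norm_sq, hu, hv, Real.cos_sub]
  simp

lemma circlePoint_ne_zero (hu : ‖u‖ = 1) (hv : ‖v‖ = 1) (huv : inner ℝ u v = 0) (t : ℝ) :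
    circlePoint u v t ≠ 0 := by
  intro h
  have := inner_circlePoint hu hv huv t t
  simp [h] at this

/-- Rotation invariance: the half-turn about the line through the point with coordinate `t / 2` acts
on the circle as `r ↦ t - r`, so it carries the pair `(s, t)` to `(t - s, 0)`. -/
lemma volume_separating_circlePoint (hu : ‖u‖ = 1) (hv : ‖v‖ = 1) (huv : inner ℝ u v = 0)
    (s t : ℝ) :
    volume.real (separating (circlePoint u v s) (circlePoint u v t)) =
      volume.real (separating (circlePoint u v 0) (circlePoint u v (t - s))) := by
  have hR : ∀ r : ℝ, (ℝ ∙ circlePoint u v (t / 2)).reflection (circlePoint u v r)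
      = circlePoint u v (t - r) := by
    intro r
    have hn : ‖circlePoint u v (t / 2)‖ ^ 2 = 1 := by
      rw [← real_inner_self_eq_norm_sq, inner_circlePoint hu hv huv]; simp
    have h1 : Real.cos (t - r) = 2 * (Real.cos (r - t / 2) * Real.cos (t / 2)) - Real.cos r := by
      have : t - r = t / 2 - (r - t / 2) := by ring
      have h2 : r = t / 2 + (r - t / 2) := by ring
      rw [this, Real.cos_sub]
      conv_rhs => rw [h2, Real.cos_add]
      ring_nf
    have h2 : Real.sin (t - r) = 2 * (Real.cos (r - t / 2) * Real.sin (t / 2)) - Real.sin r := by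
      have : t - r = t / 2 - (r - t / 2) := by ring
      have h2 : r = t / 2 + (r - t / 2) := by ring
      rw [this, Real.sin_sub]
      conv_rhs => rw [h2, Real.sin_add]
      ring_nf
    rw [Submodule.reflection_singleton_apply, inner_circlePoint hu hv huv]
    simp only [RCLike.ofReal_real_eq_id, id, hn, div_one]
    simp only [circlePoint, h1, h2]
    module
  rw [← volume_separating_isometry (ℝ ∙ circlePoint u v (t / 2)).reflection, hR, hR,
    separating_comm, sub_self]

/-- Within a half-turn the middle point is a positive combination of the outer two, so a plane
cannot cut it off from both of them. -/
lemma separating_circlePoint_mono {r s t : ℝ} (hrs : r < s) (hst : s < t) (htr : t < r + Real.pi) :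
    separating (circlePoint u v r) (circlePoint u v s)
      ⊆ separating (circlePoint u v r) (circlePoint u v t) ∧
    separating (circlePoint u v s) (circlePoint u v t)
      ⊆ separating (circlePoint u v r) (circlePoint u v t) ∧
    Disjoint (separating (circlePoint u v r) (circlePoint u v s))
      (separating (circlePoint u v s) (circlePoint u v t)) := by
  have h1 : 0 < Real.sin (t - s) := Real.sin_pos_of_pos_of_lt_pi (by linarith) (by linarith)
  have h2 : 0 < Real.sin (s - r) := Real.sin_pos_of_pos_of_lt_pi (by linarith) (by linarith)
  have h3 : 0 < Real.sin (t - r) := Real.sin_pos_of_pos_of_lt_pi (by linarith) (by linarith)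
  have key : ∀ n : E3, Real.sin (t - r) * inner ℝ n (circlePoint u v s) =
      Real.sin (t - s) * inner ℝ n (circlePoint u v r)
        + Real.sin (s - r) * inner ℝ n (circlePoint u v t) := by
    intro n
    simp only [circlePoint, inner_add_right, inner_smul_right, Real.sin_sub]
    ring
  set x := circlePoint u v r
  set y := circlePoint u v s
  set z := circlePoint u v t
  have hx : ∀ n : E3, inner ℝ n x * inner ℝ n y < 0 → inner ℝ n y * inner ℝ n z > 0 := by
    intro n h
    have hk : Real.sin (t - r) * (inner ℝ n y * inner ℝ n y) = Real.sin (t - s) *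
        (inner ℝ n x * inner ℝ n y) + Real.sin (s - r) * (inner ℝ n y * inner ℝ n z) := by
      linear_combination inner ℝ n y * key n
    have hy : inner ℝ n y ≠ 0 := by rintro h0; simp [h0] at h
    have := mul_self_pos.2 hy
    by_contra hc
    push Not at hc
    nlinarith [mul_pos h3 this, mul_nonneg h2.le (neg_nonneg.2 hc), mul_pos h1 (neg_pos.2 h)]
  refine ⟨?_, ?_, ?_⟩
  · rintro n ⟨hn, h⟩
    refine ⟨hn, ?_⟩
    have := hx n h
    have h4 := mul_neg_of_neg_of_pos h this
    by_contra hc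
    push Not at hc
    nlinarith [mul_nonneg hc (mul_self_nonneg (inner ℝ n y))]
  · rintro n ⟨hn, h⟩
    refine ⟨hn, ?_⟩
    have h5 : 0 ≤ inner ℝ n x * inner ℝ n y := by
      by_contra hc
      push Not at hc
      linarith [hx n hc]
    have hk : Real.sin (t - r) * (inner ℝ n y * inner ℝ n y) = Real.sin (t - s) *
        (inner ℝ n x * inner ℝ n y) + Real.sin (s - r) * (inner ℝ n y * inner ℝ n z) := by
      linear_combination inner ℝ n y * key n
    have hy : inner ℝ n y ≠ 0 := by rintro h0; simp [h0] at h
    have := mul_self_pos.2 hy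
    have h6 : 0 < inner ℝ n x * inner ℝ n y := by
      by_contra hc
      push Not at hc
      nlinarith [mul_pos h3 this, mul_pos h2 (neg_pos.2 h), mul_nonneg h1.le (neg_nonneg.2 hc)]
    have h4 := mul_neg_of_neg_of_pos h h6
    by_contra hc
    push Not at hc
    nlinarith [mul_nonneg hc (mul_self_nonneg (inner ℝ n y))]
  · rw [Set.disjoint_left]
    rintro n ⟨_, h⟩ ⟨_, h'⟩
    linarith [hx n h]


/-- The measure `G t` is subadditive, superadditive and monotone below `π`, and equals the full
volume at `π`. Subadditivity bounds `G (π / N)` from below, superadditivity carries this to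
multiples of `π / N`, and `N → ∞` gives the linear bound. -/
lemma le_volume_separating_circlePoint (hu : ‖u‖ = 1) (hv : ‖v‖ = 1) (huv : inner ℝ u v = 0)
    {t : ℝ} (ht0 : 0 ≤ t) (ht : t ≤ Real.pi) :
    t / Real.pi * ballVolume ≤
      volume.real (separating (circlePoint u v 0) (circlePoint u v t)) := by
  have hpi := Real.pi_pos
  have hM := ballVolume_pos
  set G : ℝ → ℝ := fun t => volume.real (separating (circlePoint u v 0) (circlePoint u v t))
    with hG
  have hGnn : ∀ t, 0 ≤ G t := fun t => measureReal_nonneg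
  have hGpi : G Real.pi = ballVolume := by
    have h : circlePoint u v Real.pi = - circlePoint u v 0 := by simp [circlePoint]
    simp only [hG, h]
    exact volume_separating_neg (circlePoint_ne_zero hu hv huv 0)
  have hsub : ∀ a b, G (a + b) ≤ G a + G b := by
    intro a b
    have := volume_separating_triangle (circlePoint u v 0) (circlePoint u v a)
      (circlePoint u v (a + b)) (circlePoint_ne_zero hu hv huv a)
    rw [volume_separating_circlePoint hu hv huv a (a + b), add_sub_cancel_left] at this
    exact this
  have hmono : ∀ a b, 0 < a → a < b → b < Real.pi → G a ≤ G b := by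
    intro a b ha hab hb
    exact measureReal_mono (separating_circlePoint_mono ha hab (by linarith)).1
      (volume_separating_ne_top _ _)
  have hsup : ∀ a b, 0 < a → 0 < b → a + b < Real.pi → G a + G b ≤ G (a + b) := by
    intro a b ha hb hab
    obtain ⟨h1, h2, h3⟩ := separating_circlePoint_mono (u := u) (v := v) ha
      (show a < a + b by linarith) (by linarith)
    have h4 := measureReal_union (μ := volume) h3 (measurableSet_separating _ _)
      (volume_separating_ne_top _ _) (volume_separating_ne_top _ _)
    rw [volume_separating_circlePoint hu hv huv a (a + b), add_sub_cancel_left] at h4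
    have h5 := measureReal_mono (Set.union_subset h1 h2) (volume_separating_ne_top _ _)
    rw [h4] at h5
    exact h5
  rcases eq_or_lt_of_le ht with rfl | htpi
  · rw [div_self hpi.ne', one_mul]; exact hGpi.ge
  have hstep : ∀ N : ℕ, 0 < N → ballVolume / N ≤ G (Real.pi / N) := by
    intro N hN
    have h : ∀ j : ℕ, G ((j + 1 : ℕ) * (Real.pi / N)) ≤ (j + 1 : ℕ) * G (Real.pi / N) := by
      intro j
      induction j with
      | zero => simp
      | succ j ih =>
        have := hsub ((j + 1 : ℕ) * (Real.pi / N)) (Real.pi / N)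
        have e : ((j + 1 + 1 : ℕ) : ℝ) * (Real.pi / N)
          = (j + 1 : ℕ) * (Real.pi / N) + Real.pi / N := by push_cast; ring
        rw [e]
        push_cast at *
        linarith
    obtain ⟨j, rfl⟩ : ∃ j, N = j + 1 := ⟨N - 1, by omega⟩
    have := h j
    have hj : ((j + 1 : ℕ) : ℝ) ≠ 0 := by positivity
    rw [mul_div_cancel₀ _ hj, hGpi] at this
    rw [div_le_iff₀ (by positivity)]
    linarith
  have hmul : ∀ (x : ℝ) (m : ℕ), 0 < x → (m + 1 : ℕ) * x < Real.pi →
      (m + 1 : ℕ) * G x ≤ G ((m + 1 : ℕ) * x) := by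
    intro x m hx
    induction m with
    | zero => simp
    | succ m ih =>
      intro hlt
      have e : ((m + 1 + 1 : ℕ) : ℝ) * x = (m + 1 : ℕ) * x + x := by push_cast; ring
      rw [e] at hlt ⊢
      have h1 := ih (by linarith)
      have h2 := hsup ((m + 1 : ℕ) * x) x (by positivity) hx hlt
      push_cast at *
      linarith
  -- Rounding `t` down to a multiple of `π / N` costs at most `ballVolume / N`.
  have hN : ∀ N : ℕ, 0 < N → t / Real.pi * ballVolume ≤ G t + ballVolume / N := by
    intro N hN
    have hN' : (0 : ℝ) < N := by exact_mod_cast hN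
    rcases hm : ⌊t * N / Real.pi⌋₊ with _ | m
    · rw [Nat.floor_eq_zero, div_lt_one hpi] at hm
      have : t / Real.pi ≤ 1 / N := by rw [div_le_div_iff₀ hpi hN']; linarith
      have := mul_le_mul_of_nonneg_right this hM.le
      have h3 := hGnn t
      rw [one_div_mul_eq_div] at this
      linarith
    · have h0 : 0 ≤ t * N / Real.pi := by positivity
      have h1 := Nat.floor_le h0
      have h2 := Nat.lt_floor_add_one (t * N / Real.pi)
      rw [hm] at h1 h2
      rw [le_div_iff₀ hpi] at h1
      rw [div_lt_iff₀ hpi] at h2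
      have h3 : ((m + 1 : ℕ) : ℝ) * (Real.pi / N) ≤ t := by
        rw [← mul_div_assoc, div_le_iff₀ hN']; exact h1
      have hx : 0 < Real.pi / N := by positivity
      have h4 := hmul (Real.pi / N) m hx (by linarith)
      have h5 : G ((m + 1 : ℕ) * (Real.pi / N)) ≤ G t := by
        rcases eq_or_lt_of_le h3 with h | h
        · rw [h]
        · exact hmono _ _ (by positivity) h htpi
      have h6 := hstep N hN
      have h7 : t / Real.pi ≤ ((m + 1 : ℕ) + 1) / N := by
        rw [div_le_div_iff₀ hpi hN']; linarith
      have h8 := mul_le_mul_of_nonneg_right h7 hM.le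
      have h9 : (((m + 1 : ℕ) : ℝ) + 1) / N * ballVolume
        = (m + 1 : ℕ) * (ballVolume / N) + ballVolume / N := by field_simp
      have h10 : ((m + 1 : ℕ) : ℝ) * (ballVolume / N) ≤ (m + 1 : ℕ) * G (Real.pi / N) := by
        gcongr
      linarith
  refine ge_of_tendsto (x := Filter.atTop) (f := fun N : ℕ => G t + ballVolume / N) ?_ ?_
  · simpa using (tendsto_const_nhds (x := G t)).add
      (tendsto_const_div_atTop_nhds_zero_nat ballVolume)
  · filter_upwards [Filter.eventually_gt_atTop 0] with N h using hN N h

end Circle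

/-- The planes that separate two vectors are at least as frequent as their angle is large. -/
lemma angle_le_volume_separating {u v : E3} (hu : u ≠ 0) (hv : v ≠ 0) :
    InnerProductGeometry.angle u v / Real.pi * ballVolume ≤ volume.real (separating u v) := by
  have hpi := Real.pi_pos
  set t := InnerProductGeometry.angle u v with ht
  have ht0 : 0 ≤ t := InnerProductGeometry.angle_nonneg _ _
  have htpi : t ≤ Real.pi := InnerProductGeometry.angle_le_pi _ _
  have hnu := norm_pos_iff.2 hu
  have hnv := norm_pos_iff.2 hv
  rcases eq_or_lt_of_le htpi with h | h
  · obtain ⟨_, r, hr, rfl⟩ := InnerProductGeometry.angle_eq_pi_iff.1 h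
    have e : separating u (r • u) = separating u (-u) := by
      have := separating_smul one_pos (neg_pos.2 hr) u (-u)
      simpa using this
    rw [e, volume_separating_neg hu, h, div_self hpi.ne', one_mul]
  rcases eq_or_lt_of_le ht0 with h0 | h0
  · rw [← h0]; simp
  have hs : 0 < Real.sin t := Real.sin_pos_of_pos_of_lt_pi h0 h
  -- Gram–Schmidt: in the orthonormal frame `u₁, v₁` the directions of `u` and `v` have circle
  -- coordinates `0` and `t`.
  set u₁ := ‖u‖⁻¹ • u with hu₁
  set v₁ := (Real.sin t)⁻¹ • (‖v‖⁻¹ • v - Real.cos t • u₁) with hv₁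
  have hin : inner ℝ u v = ‖u‖ * ‖v‖ * Real.cos t := by
    rw [mul_comm, ht, InnerProductGeometry.cos_angle_mul_norm_mul_norm]
  have hu1 : ‖u₁‖ = 1 := by rw [hu₁, norm_smul, norm_inv, norm_norm, inv_mul_cancel₀ hnu.ne']
  have hin1 : inner ℝ u₁ (‖v‖⁻¹ • v) = Real.cos t := by
    rw [hu₁, inner_smul_left, inner_smul_right, hin]
    simp only [conj_trivial]
    field_simp
  have huv : inner ℝ u₁ v₁ = 0 := by
    rw [hv₁, inner_smul_right, inner_sub_right, hin1, inner_smul_right,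
      real_inner_self_eq_norm_sq, hu1]
    simp
  have hv1 : ‖v₁‖ = 1 := by
    have h2 : ‖‖v‖⁻¹ • v‖ = 1 := by rw [norm_smul, norm_inv, norm_norm, inv_mul_cancel₀ hnv.ne']
    have h3 : ‖‖v‖⁻¹ • v - Real.cos t • u₁‖ ^ 2 = Real.sin t ^ 2 := by
      rw [@norm_sub_sq_real, inner_smul_right, real_inner_comm, hin1, h2, norm_smul, hu1,
        Real.sin_sq, mul_one, Real.norm_eq_abs, sq_abs]
      ring
    have h4 : ‖‖v‖⁻¹ • v - Real.cos t • u₁‖ = Real.sin t :=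
      (sq_eq_sq₀ (norm_nonneg _) hs.le).1 h3
    rw [hv₁, norm_smul, h4, norm_inv, Real.norm_eq_abs, abs_of_pos hs, inv_mul_cancel₀ hs.ne']
  have e1 : u = ‖u‖ • circlePoint u₁ v₁ 0 := by
    simp [circlePoint, hu₁, smul_smul, hnu.ne']
  have e2 : v = ‖v‖ • circlePoint u₁ v₁ t := by
    simp [circlePoint, hv₁, smul_smul, hnv.ne', hs.ne']
  have := le_volume_separating_circlePoint hu1 hv1 huv ht0 htpi
  rw [← separating_smul hnu hnv, ← e1, ← e2] at this
  exact this

/-! ### Sign changes and total angles -/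

/-- Zeros may lie between sign changes, so the four indices are picked from the ends of three sign
changes `a < b < c`: comparing `f a` with `f b`, and `f b` with `f c`, decides which ends to keep.
-/
lemma exists_alternating {f : ℕ → ℝ} {N : ℕ}
    (h : 2 < ((Finset.range N).filter fun j => f j * f (j + 1) < 0).card) :
    ∃ i j k l, i < j ∧ j < k ∧ k < l ∧ l ≤ N ∧ f i * f j < 0 ∧ f j * f k < 0 ∧ f k * f l < 0 := by
  obtain ⟨a, b, c, ha, hb, hc, hab, hac, hbc⟩ := Finset.two_lt_card_iff.1 h
  have main : ∀ a b c : ℕ, a < b → b < c → c < N → f a * f (a + 1) < 0 → f b * f (b + 1) < 0 →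
      f c * f (c + 1) < 0 → ∃ i j k l, i < j ∧ j < k ∧ k < l ∧ l ≤ N ∧
        f i * f j < 0 ∧ f j * f k < 0 ∧ f k * f l < 0 := by
    intro a b c hab hbc hcN ha hb hc
    have hpos : ∀ x y z : ℝ, x * y < 0 → 0 < x * z → y * z < 0 := by
      intro x y z h1 h2
      by_contra h3
      push Not at h3
      have hx : 0 < x * x := mul_self_pos.2 (by rintro rfl; simp at h1)
      nlinarith [mul_neg_of_neg_of_pos h1 h2]
    have hneg : ∀ x y z : ℝ, x * y < 0 → x * z < 0 → 0 < y * z := by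
      intro x y z h1 h2
      by_contra h3
      push Not at h3
      have hx : 0 < x * x := mul_self_pos.2 (by rintro rfl; simp at h1)
      nlinarith [mul_pos_of_neg_of_neg h1 h2]
    have nz : ∀ x y : ℝ, x * y < 0 → x ≠ 0 ∧ y ≠ 0 := by
      intro x y h
      constructor <;> rintro rfl <;> simp at h
    have tri : ∀ x y : ℝ, x ≠ 0 → y ≠ 0 → x * y < 0 ∨ 0 < x * y := fun x y hx hy =>
      lt_or_gt_of_ne (mul_ne_zero hx hy)
    rcases tri (f a) (f b) (nz _ _ ha).1 (nz _ _ hb).1 with h1 | h1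
    · rcases tri (f b) (f c) (nz _ _ hb).1 (nz _ _ hc).1 with h2 | h2
      · exact ⟨a, b, c, c + 1, hab, hbc, by omega, by omega, h1, h2, hc⟩
      · have h3 : f (b + 1) * f c < 0 := hpos _ _ _ hb h2
        have h4 : b + 1 ≠ c := by
          rintro rfl
          exact absurd h3 (not_lt.2 (mul_self_nonneg _))
        exact ⟨a, b, b + 1, c, hab, by omega, by omega, by omega, h1, hb, h3⟩
    · have h3 : f (a + 1) * f b < 0 := hpos _ _ _ ha h1
      have h4 : a + 1 ≠ b := by
        rintro rfl
        exact absurd h3 (not_lt.2 (mul_self_nonneg _))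
      exact ⟨a, a + 1, b, b + 1, by omega, by omega, by omega, by omega, ha, h3, hb⟩
  simp only [Finset.mem_filter, Finset.mem_range] at ha hb hc
  rcases lt_or_gt_of_ne hab with h1 | h1 <;> rcases lt_or_gt_of_ne hac with h2 | h2 <;>
    rcases lt_or_gt_of_ne hbc with h3 | h3
  · exact main a b c h1 h3 hc.1 ha.2 hb.2 hc.2
  · exact main a c b h2 h3 hb.1 ha.2 hc.2 hb.2
  · omega
  · exact main c a b h2 h1 hb.1 hc.2 ha.2 hb.2
  · exact main b a c h1 h2 hc.1 hb.2 ha.2 hc.2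
  · omega
  · exact main b c a h3 h2 ha.1 hb.2 hc.2 ha.2
  · exact main c b a h3 h1 ha.1 hc.2 hb.2 ha.2

/-- If every plane through the origin separates at most two pairs of consecutive vectors of a
sequence, the sum of the angles between consecutive vectors is at most `2π`; it is smaller if
some planes do not separate any of the pairs. -/
lemma sum_angle_le {x : ℕ → E3} {N : ℕ} (hx : ∀ j ≤ N, x j ≠ 0)
    (hchange : ∀ n : E3,
      ((Finset.range N).filter fun j => inner ℝ n (x j) * inner ℝ n (x (j + 1)) < 0).card ≤ 2)
    {U : Set E3} (hU : MeasurableSet U) (hUball : U ⊆ Metric.ball 0 1)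
    (hUx : ∀ n ∈ U, ∀ j < N, 0 ≤ inner ℝ n (x j) * inner ℝ n (x (j + 1))) :
    ∑ j ∈ Finset.range N, InnerProductGeometry.angle (x j) (x (j + 1))
      ≤ 2 * Real.pi * (1 - volume.real U / ballVolume) := by
  classical
  have hpi := Real.pi_pos
  have hM := ballVolume_pos
  -- Fubini: for a normal `n`, the sum of the indicators counts the separated pairs, which is at
  -- most `2` in the ball and `0` on `U`.
  have h1 : ∑ j ∈ Finset.range N, volume (separating (x j) (x (j + 1)))
      ≤ 2 * volume (Metric.ball (0 : E3) 1 \ U) := by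
    have e : ∀ j, volume (separating (x j) (x (j + 1)))
        = ∫⁻ n, (separating (x j) (x (j + 1))).indicator 1 n := fun j =>
      (lintegral_indicator_one (measurableSet_separating _ _)).symm
    have e2 : 2 * volume (Metric.ball (0 : E3) 1 \ U)
        = ∫⁻ n, (Metric.ball (0 : E3) 1 \ U).indicator (fun _ => 2) n := by
      rw [lintegral_indicator_const (measurableSet_ball.diff hU)]
    simp only [e]
    rw [e2, ← lintegral_finsetSum _ fun j _ =>
      measurable_one.indicator (measurableSet_separating _ _)]
    refine lintegral_mono fun n => ?_
    by_cases hn : n ∈ Metric.ball (0 : E3) 1 \ U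
    · rw [Set.indicator_of_mem hn]
      have e3 : ∑ j ∈ Finset.range N,
          (separating (x j) (x (j + 1))).indicator (1 : E3 → ENNReal) n
          = (((Finset.range N).filter
            fun j => inner ℝ n (x j) * inner ℝ n (x (j + 1)) < 0).card : ENNReal) := by
        rw [Finset.card_filter]
        push_cast
        refine Finset.sum_congr rfl fun j _ => ?_
        simp only [Set.indicator, separating, Set.mem_ofPred_eq, hn.1, true_and, Pi.one_apply]
      rw [e3]
      refine (Nat.cast_le.2 (?_ : _ ≤ 2)).trans Nat.cast_ofNat.le
      convert hchange n
    · rw [Set.indicator_of_notMem hn]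
      refine (Finset.sum_eq_zero fun j hj => ?_).le
      rw [Set.indicator_of_notMem]
      rintro ⟨hb, h⟩
      refine hn ⟨hb, fun hnU => ?_⟩
      exact absurd h (not_lt.2 (hUx n hnU j (Finset.mem_range.1 hj)))
  have h2 : ∑ j ∈ Finset.range N, volume.real (separating (x j) (x (j + 1)))
      ≤ 2 * (ballVolume - volume.real U) := by
    have h3 : volume.real (Metric.ball (0 : E3) 1 \ U) = ballVolume - volume.real U :=
      measureReal_sdiff hUball hU measure_ball_lt_top.ne
    have hne : volume (Metric.ball (0 : E3) 1 \ U) ≠ ⊤ :=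
      ((measure_mono Set.sdiff_subset).trans_lt measure_ball_lt_top).ne
    have := ENNReal.toReal_mono (ENNReal.mul_ne_top (by simp) hne) h1
    rw [ENNReal.toReal_sum fun j _ => volume_separating_ne_top _ _, ENNReal.toReal_mul] at this
    rw [← h3]
    simpa [measureReal_def] using this
  have h3 : (∑ j ∈ Finset.range N, InnerProductGeometry.angle (x j) (x (j + 1)))
      / Real.pi * ballVolume ≤ 2 * (ballVolume - volume.real U) := by
    rw [Finset.sum_div, Finset.sum_mul]
    refine le_trans (Finset.sum_le_sum fun j hj => ?_) h2
    have := Finset.mem_range.1 hj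
    exact angle_le_volume_separating (hx j (by omega)) (hx (j + 1) (by omega))
  rw [div_mul_eq_mul_div, div_le_iff₀ hpi] at h3
  have e : 2 * Real.pi * (1 - volume.real U / ballVolume)
      = 2 * (ballVolume - volume.real U) * Real.pi / ballVolume := by field_simp
  rw [e, le_div_iff₀ hM]
  exact h3

/-! ### Convexity -/

lemma isClosed_body (V : Finset E3) : IsClosed (body V) :=
  (V.finite_toSet.isCompact_convexHull (𝕜 := ℝ)).isClosed

lemma convex_body (V : Finset E3) : Convex ℝ (body V) := convex_convexHull ℝ _

lemma surface_subset_body (V : Finset E3) : surface V ⊆ body V :=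
  (isClosed_body V).frontier_subset

lemma notMem_interior_of_mem_surface {V : Finset E3} {x : E3} (hx : x ∈ surface V) :
    x ∉ interior (body V) := hx.2

lemma mem_surface_of_mem_star {V : Finset E3} {o x : E3} (hx : x ∈ star V o) : x ∈ surface V :=
  hx (right_mem_segment ℝ o x)

lemma apex_mem_surface_of_mem_star {V : Finset E3} {o x : E3} (hx : x ∈ star V o) :
    o ∈ surface V := hx (left_mem_segment ℝ o x)

lemma mem_body_of_mem_star {V : Finset E3} {o x : E3} (hx : x ∈ star V o) : x ∈ body V :=
  surface_subset_body V (mem_surface_of_mem_star hx)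

/-- A ray in the boundary of the cone spanned by a convex body does not meet the interior of the
cone. -/
lemma not_interior_relation {V : Finset E3} {o c p q r : E3} (hc : c ∈ interior (body V))
    (hp : p ∈ body V) (hq : q ∈ body V) (hr : r ∈ star V o) {d a b e : ℝ} (hd : 0 < d)
    (ha : 0 ≤ a) (hb : 0 ≤ b) (he : 0 ≤ e)
    (h : d • (c - o) + a • (p - o) + b • (q - o) = e • (r - o)) : False := by
  have hconv := convex_body V
  have hda : 0 < d + a := by positivity
  have hS : 0 < d + a + b := by positivity
  have h1 : (d / (d + a)) • c + (a / (d + a)) • p ∈ interior (body V) :=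
    hconv.combo_interior_self_mem_interior hc hp (by positivity) (by positivity)
      (by field_simp)
  have h2 := hconv.combo_interior_self_mem_interior (a := (d + a) / (d + a + b))
    (b := b / (d + a + b)) h1 hq (by positivity) (by positivity) (by field_simp)
  -- The left-hand side, normalized to a convex combination, is an interior point `m`, since `c` has
  -- positive weight; by the relation it lies on the ray from `o` through `r`.
  set m := ((d + a) / (d + a + b)) • ((d / (d + a)) • c + (a / (d + a)) • p)
    + (b / (d + a + b)) • q with hm
  have hm' : m = o + (e / (d + a + b)) • (r - o) := by
    have : (d + a + b) • m = (d + a + b) • (o + (e / (d + a + b)) • (r - o)) := by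
      rw [smul_add (d + a + b) o, smul_smul, mul_div_cancel₀ _ hS.ne', ← h, hm]
      simp only [smul_add, smul_smul]
      have e1 : (d + a + b) * ((d + a) / (d + a + b) * (d / (d + a))) = d := by field_simp
      have e2 : (d + a + b) * ((d + a) / (d + a + b) * (a / (d + a))) = a := by field_simp
      have e3 : (d + a + b) * (b / (d + a + b)) = b := by field_simp
      rw [e1, e2, e3]
      module
    exact smul_right_injective E3 hS.ne' this
  -- If `m` lies on the segment from `o` to `r`, that segment leaves the surface; if `m` lies beyond
  -- `r`, then `r` is itself interior.
  by_cases hle : e / (d + a + b) ≤ 1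
  · refine notMem_interior_of_mem_surface (hr ?_) h2
    rw [segment_eq_image']
    exact ⟨e / (d + a + b), ⟨by positivity, hle⟩, hm'.symm⟩
  · push Not at hle
    refine notMem_interior_of_mem_surface (mem_surface_of_mem_star hr) ?_
    set f := e / (d + a + b) with hf
    have hf0 : 0 < f := by linarith
    have : r = (1 / f) • m + (1 - 1 / f) • o := by
      rw [hm', smul_add, smul_smul, one_div, inv_mul_cancel₀ hf0.ne']
      module
    rw [this]
    have h3 : 1 / f ≤ 1 := by rw [div_le_one hf0]; exact hle.le
    exact hconv.combo_interior_self_mem_interior h2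
      (surface_subset_body V (apex_mem_surface_of_mem_star hr)) (by positivity) (by linarith)
      (by ring)

/-- The centroid of the spanning points is an interior point. -/
lemma centroid_mem_interior {V : Finset E3} (hV : (interior (body V)).Nonempty) :
    V.centroid ℝ id ∈ interior (body V) := by
  -- Otherwise a linear function is at most its value at the centroid on the whole body. As that
  -- value is the mean over the spanning points, the function is constant on them, and the body
  -- would lie in a hyperplane.
  by_contra hc
  obtain ⟨f, hf⟩ := geometric_hahn_banach_open_point (convex_body V).interior isOpen_interior hc
  have hne : V.Nonempty := by
    rw [Finset.nonempty_iff_ne_empty]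
    rintro rfl
    simp [body] at hV
  have hcard : (V.card : ℝ) ≠ 0 := by exact_mod_cast hne.card_ne_zero
  have hle : ∀ x ∈ body V, f x ≤ f (V.centroid ℝ id) := by
    intro x hx
    have h1 : x ∈ closure (interior (body V)) := by
      rw [(convex_body V).closure_interior_eq_closure_of_nonempty_interior hV]
      exact subset_closure hx
    have h2 : IsClosed {y : E3 | f y ≤ f (V.centroid ℝ id)} :=
      isClosed_le f.continuous continuous_const
    exact closure_minimal (fun y hy => (hf y hy).le) h2 h1
  have hcen : (V.card : ℝ) * f (V.centroid ℝ id) = ∑ v ∈ V, f v := by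
    rw [Finset.centroid_def, Finset.affineCombination_eq_linear_combination _ _ _
      (Finset.sum_centroidWeights_eq_one_of_nonempty ℝ V hne)]
    simp [Finset.centroidWeights, ← Finset.mul_sum, mul_inv_cancel₀ hcard,
      ← mul_assoc]
  have heq : ∀ v ∈ V, f v = f (V.centroid ℝ id) := by
    refine (Finset.sum_eq_sum_iff_of_le fun v hv => hle v (subset_convexHull ℝ _ hv)).1 ?_
    rw [Finset.sum_const, nsmul_eq_mul, hcen]
  obtain ⟨x, hx⟩ := hV
  have h3 : x ∈ {y : E3 | f y = f (V.centroid ℝ id)} := by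
    have hcv : Convex ℝ {y : E3 | f y = f (V.centroid ℝ id)} :=
      convex_hyperplane f.toLinearMap.isLinear _
    exact convexHull_min (fun v hv => heq v hv) hcv (interior_subset hx)
  exact absurd (hf x hx) (by rw [h3]; exact lt_irrefl _)

/-! ### Azimuths -/

lemma inner_eq_coordinates (x y : E3) : inner ℝ x y = x 0 * y 0 + x 1 * y 1 + x 2 * y 2 := by
  simp [PiLp.inner_apply, Fin.sum_univ_three, mul_comm]

lemma norm_sq_eq_coordinates (x : E3) : ‖x‖ ^ 2 = x 0 ^ 2 + x 1 ^ 2 + x 2 ^ 2 := by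
  rw [← real_inner_self_eq_norm_sq, inner_eq_coordinates]; ring

lemma det3_eq (a b c : E3) : det3 a b c = a 0 * b 1 * c 2 - a 0 * b 2 * c 1 - a 1 * b 0 * c 2
    + a 1 * b 2 * c 0 + a 2 * b 0 * c 1 - a 2 * b 1 * c 0 := by
  simp [det3, Matrix.det_fin_three]

/-- The Gram determinant of two vectors. -/
noncomputable def gram (w x : E3) : ℝ := ‖x‖ ^ 2 * ‖w‖ ^ 2 - inner ℝ x w ^ 2

lemma rotation_re (w b x : E3) :
    (rotation w b x).re = inner ℝ b x * ‖w‖ ^ 2 - inner ℝ b w * inner ℝ x w := rfl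

lemma rotation_im (w b x : E3) : (rotation w b x).im = ‖w‖ * det3 b x (-w) := rfl

/-- Lagrange's identity for the projections; it shows that the azimuth degenerates only for vectors
parallel to the axis. -/
lemma normSq_rotation (w b x : E3) :
    Complex.normSq (rotation w b x) = gram w b * gram w x := by
  have h : ‖w‖ * det3 b x (-w) * (‖w‖ * det3 b x (-w)) = ‖w‖ ^ 2 * det3 b x (-w) ^ 2 := by ring
  rw [Complex.normSq_apply, rotation_re, rotation_im, h]
  simp only [gram, det3_eq, inner_eq_coordinates, norm_sq_eq_coordinates, PiLp.neg_apply]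
  ring

/-- Turning from `b` to `a` and then from `a` to `x` amounts to turning from `b` to `x`: this makes
azimuths additive. -/
lemma rotation_mul_rotation (w b a x : E3) :
    rotation w b a * rotation w a x = (gram w a : ℂ) * rotation w b x := by
  have h : ‖w‖ * det3 b a (-w) * (‖w‖ * det3 a x (-w))
      = ‖w‖ ^ 2 * (det3 b a (-w) * det3 a x (-w)) := by ring
  apply Complex.ext
  · rw [Complex.mul_re, Complex.re_ofReal_mul, rotation_re, rotation_im, rotation_re, rotation_im,
      rotation_re, h]
    simp only [gram, det3_eq, inner_eq_coordinates, norm_sq_eq_coordinates, PiLp.neg_apply]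
    ring
  · rw [Complex.mul_im, Complex.im_ofReal_mul, rotation_re, rotation_im, rotation_re, rotation_im,
      rotation_im]
    have : (inner ℝ b a * ‖w‖ ^ 2 - inner ℝ b w * inner ℝ a w) * det3 a x (-w)
        + det3 b a (-w) * (inner ℝ a x * ‖w‖ ^ 2 - inner ℝ a w * inner ℝ x w)
        = gram w a * det3 b x (-w) := by
      simp only [gram, det3_eq, inner_eq_coordinates, norm_sq_eq_coordinates, PiLp.neg_apply]
      ring
    linear_combination ‖w‖ * this

lemma rotation_swap (w a b : E3) : rotation w a b = (starRingEnd ℂ) (rotation w b a) := by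
  apply Complex.ext
  · rw [Complex.conj_re, rotation_re, rotation_re, real_inner_comm]; ring
  · rw [Complex.conj_im, rotation_im, rotation_im]
    simp only [det3_eq]; ring

lemma im_conj_rotation_mul (w b p q : E3) :
    ((starRingEnd ℂ) (rotation w b p) * rotation w b q).im
      = gram w b * (‖w‖ * det3 p q (-w)) := by
  rw [← rotation_swap, rotation_mul_rotation, Complex.im_ofReal_mul, rotation_im]

lemma rotation_smul_sub_smul (w b x y : E3) (r s : ℝ) :
    rotation w b (r • x - s • y) = r * rotation w b x - s * rotation w b y := by
  apply Complex.ext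
  · simp only [rotation_re, Complex.sub_re, Complex.re_ofReal_mul, inner_sub_right,
      inner_sub_left, inner_smul_left, inner_smul_right, conj_trivial]
    ring
  · simp only [rotation_im, Complex.sub_im, Complex.im_ofReal_mul, det3_eq, PiLp.sub_apply,
      PiLp.smul_apply, smul_eq_mul]
    ring

lemma gram_nonneg (w x : E3) : 0 ≤ gram w x := by
  have h := abs_real_inner_le_norm x w
  have := sq_le_sq' (by linarith [neg_abs_le (inner ℝ x w), abs_nonneg (inner ℝ x w)])
    ((le_abs_self _).trans h)
  rw [mul_pow] at this
  unfold gram; linarith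

lemma smul_eq_of_gram_eq_zero {w x : E3} (h : gram w x = 0) :
    ‖w‖ ^ 2 • x = inner ℝ x w • w := by
  rw [← sub_eq_zero, ← norm_eq_zero, ← sq_eq_zero_iff]
  have : ‖‖w‖ ^ 2 • x - inner ℝ x w • w‖ ^ 2 = ‖w‖ ^ 2 * gram w x := by
    simp only [gram, inner_eq_coordinates, norm_sq_eq_coordinates, PiLp.sub_apply,
      PiLp.smul_apply, smul_eq_mul]
    ring
  rw [this, h, mul_zero]

/-- The real number `t` is an angular coordinate of `x` around the axis through `o`. -/
def HasLift (V : Finset E3) (o b x : E3) (t : ℝ) : Prop :=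
  ∃ r : ℝ, 0 < r ∧ azimuth V o b x = r * Complex.exp (t * Complex.I)

/-! ### Boundary rays of a convex cone and planes through its apex -/

section Star

variable {V : Finset E3} {o b : E3}

lemma centroid_sub_ne_zero (hc : V.centroid ℝ id ∈ interior (body V)) {x : E3}
    (hx : x ∈ star V o) : V.centroid ℝ id - o ≠ 0 := by
  intro h
  rw [sub_eq_zero] at h
  exact notMem_interior_of_mem_surface (apex_mem_surface_of_mem_star hx) (h ▸ hc)

/-- No ray of the star is parallel to the axis: pointing along it, the ray would enter the interior;
pointing against it, `o` would be an interior point. -/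
lemma gram_pos (hc : V.centroid ℝ id ∈ interior (body V)) {x : E3} (hx : x ∈ star V o)
    (hxo : x ≠ o) : 0 < gram (V.centroid ℝ id - o) (x - o) := by
  refine lt_of_le_of_ne (gram_nonneg _ _) fun h => ?_
  have hw := centroid_sub_ne_zero hc hx
  have hw2 : 0 < ‖V.centroid ℝ id - o‖ ^ 2 := by positivity
  have h1 := smul_eq_of_gram_eq_zero h.symm
  set w := V.centroid ℝ id - o with hwdef
  have hxb := mem_body_of_mem_star hx
  rcases lt_trichotomy (inner ℝ (x - o) w) 0 with h2 | h2 | h2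
  · refine not_interior_relation hc hxb hxb hx (d := -inner ℝ (x - o) w) (a := ‖w‖ ^ 2) (b := 0)
      (e := 0) (by linarith) hw2.le le_rfl le_rfl ?_
    rw [← hwdef, h1]; module
  · rw [h2, zero_smul, smul_eq_zero] at h1
    rcases h1 with h1 | h1
    · exact hw2.ne' h1
    · exact hxo (sub_eq_zero.1 h1)
  · refine not_interior_relation hc hxb hxb hx (d := inner ℝ (x - o) w) (a := 0) (b := 0)
      (e := ‖w‖ ^ 2) h2 le_rfl le_rfl hw2.le ?_
    rw [h1]; simp [hwdef]

lemma azimuth_ne_zero (hc : V.centroid ℝ id ∈ interior (body V)) (hb : b ∈ star V o)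
    (hbo : b ≠ o) {x : E3} (hx : x ∈ star V o) (hxo : x ≠ o) : azimuth V o b x ≠ 0 := by
  intro h
  have h1 := normSq_rotation (V.centroid ℝ id - o) (b - o) (x - o)
  have h2 : rotation (V.centroid ℝ id - o) (b - o) (x - o) = 0 := h
  rw [h2, map_zero] at h1
  exact (mul_pos (gram_pos hc hb hbo) (gram_pos hc hx hxo)).ne h1

/-- Translates the cyclic order of azimuths into orientations of triples, to which linear algebra
applies. -/
lemma det3_of_hasLift {x y : E3} {s t : ℝ} (hc : V.centroid ℝ id ∈ interior (body V))
    (hb : b ∈ star V o) (hbo : b ≠ o) (hx : HasLift V o b x s) (hy : HasLift V o b y t) :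
    ∃ m : ℝ, 0 < m ∧
      det3 (x - o) (y - o) (-(V.centroid ℝ id - o)) = m * Real.sin (t - s) := by
  obtain ⟨r, hr, hx⟩ := hx
  obtain ⟨r', hr', hy⟩ := hy
  have hg := gram_pos hc hb hbo
  have hw : 0 < ‖V.centroid ℝ id - o‖ := norm_pos_iff.2 (centroid_sub_ne_zero hc hb)
  have h := im_conj_rotation_mul (V.centroid ℝ id - o) (b - o) (x - o) (y - o)
  have hx' : rotation (V.centroid ℝ id - o) (b - o) (x - o) = _ := hx
  have hy' : rotation (V.centroid ℝ id - o) (b - o) (y - o) = _ := hy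
  have e : (starRingEnd ℂ) (r * Complex.exp (s * Complex.I)) * (r' * Complex.exp (t * Complex.I))
      = (r * r' : ℝ) * Complex.exp ((t - s : ℝ) * Complex.I) := by
    rw [map_mul, Complex.conj_ofReal, ← Complex.exp_conj, map_mul, Complex.conj_ofReal,
      Complex.conj_I]
    rw [mul_mul_mul_comm, ← Complex.exp_add]
    push_cast
    ring_nf
  rw [hx', hy', e, Complex.im_ofReal_mul, Complex.exp_ofReal_mul_I_im] at h
  refine ⟨r * r' / (gram (V.centroid ℝ id - o) (b - o) * ‖V.centroid ℝ id - o‖),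
    by positivity, ?_⟩
  field_simp
  linear_combination -h

/-- Rays with equal azimuth coincide: a suitable combination of them is parallel to the axis, and
unless it vanishes, one ray is the other pushed into the interior of the cone. -/
lemma not_opposite_of_hasLift {x y n : E3} {t : ℝ} (hc : V.centroid ℝ id ∈ interior (body V))
    (hb : b ∈ star V o) (hbo : b ≠ o) (hxs : x ∈ star V o) (hys : y ∈ star V o)
    (hx : HasLift V o b x t) (hy : HasLift V o b y t)
    (hnx : inner ℝ n (x - o) < 0) (hny : 0 < inner ℝ n (y - o)) : False := by
  obtain ⟨r, hr, hx⟩ := hx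
  obtain ⟨s, hs, hy⟩ := hy
  set w := V.centroid ℝ id - o with hwdef
  have hw2 : 0 < ‖w‖ ^ 2 := by
    have := centroid_sub_ne_zero hc hb
    positivity
  have hx' : rotation w (b - o) (x - o) = _ := hx
  have hy' : rotation w (b - o) (y - o) = _ := hy
  have h0 : rotation w (b - o) (s • (x - o) - r • (y - o)) = 0 := by
    rw [rotation_smul_sub_smul, hx', hy']; ring
  have h1 := normSq_rotation w (b - o) (s • (x - o) - r • (y - o))
  rw [h0, map_zero] at h1
  have h2 := smul_eq_of_gram_eq_zero
    ((mul_eq_zero.1 h1.symm).resolve_left (gram_pos hc hb hbo).ne')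
  set l := inner ℝ (s • (x - o) - r • (y - o)) w
  have hxb := mem_body_of_mem_star hxs
  have hyb := mem_body_of_mem_star hys
  rcases lt_trichotomy l 0 with h3 | h3 | h3
  · refine not_interior_relation hc hxb hxb hys (d := -l) (a := ‖w‖ ^ 2 * s) (b := 0)
      (e := ‖w‖ ^ 2 * r) (by linarith) (by positivity) le_rfl (by positivity) ?_
    rw [← hwdef, neg_smul, ← h2]; module
  · rw [h3, zero_smul, smul_eq_zero] at h2
    have h4 := h2.resolve_left hw2.ne'
    have h5 : inner ℝ n (s • (x - o) - r • (y - o)) = 0 := by rw [h4, inner_zero_right]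
    rw [inner_sub_right, inner_smul_right, inner_smul_right] at h5
    nlinarith [mul_pos hr hny, mul_pos hs (neg_pos.2 hnx)]
  · refine not_interior_relation hc hyb hyb hxs (d := l) (a := ‖w‖ ^ 2 * r) (b := 0)
      (e := ‖w‖ ^ 2 * s) h3 (by positivity) le_rfl (by positivity) ?_
    rw [← hwdef, ← h2]; module

/-- Cramer's rule for four vectors in space; it compares the middle ray with the outer rays and the
axis. -/
lemma det3_relation (x y z w : E3) :
    det3 y z (-w) • x + det3 x y (-w) • z + det3 x y z • w = det3 x z (-w) • y := by
  ext i
  fin_cases i <;>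
  · simp only [det3_eq, PiLp.add_apply, PiLp.smul_apply, PiLp.neg_apply, smul_eq_mul,
      Fin.zero_eta, Fin.mk_one, Fin.reduceFinMk, Fin.isValue]
    ring

/-- A plane through the apex has no three consecutive rays of the boundary of a convex cone, within
a half-turn, on alternating sides, the middle one on the side of the axis. -/
lemma not_separated_middle {x y z n : E3} {r s t : ℝ}
    (hc : V.centroid ℝ id ∈ interior (body V)) (hb : b ∈ star V o) (hbo : b ≠ o)
    (hxs : x ∈ star V o) (hys : y ∈ star V o) (hzs : z ∈ star V o)
    (hx : HasLift V o b x r) (hy : HasLift V o b y s) (hz : HasLift V o b z t)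
    (hrs : r ≤ s) (hst : s ≤ t) (htr : t ≤ r + Real.pi)
    (hnx : inner ℝ n (x - o) < 0) (hny : 0 < inner ℝ n (y - o)) (hnz : inner ℝ n (z - o) < 0)
    (hnw : 0 ≤ inner ℝ n (V.centroid ℝ id - o)) : False := by
  obtain ⟨m₁, hm₁, hA⟩ := det3_of_hasLift hc hb hbo hy hz
  obtain ⟨m₂, hm₂, hB⟩ := det3_of_hasLift hc hb hbo hx hy
  obtain ⟨m₃, hm₃, hE⟩ := det3_of_hasLift hc hb hbo hx hz
  have hrel := det3_relation (x - o) (y - o) (z - o) (V.centroid ℝ id - o)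
  have h1 : 0 ≤ Real.sin (t - s) := Real.sin_nonneg_of_nonneg_of_le_pi (by linarith) (by linarith)
  have h2 : 0 ≤ Real.sin (s - r) := Real.sin_nonneg_of_nonneg_of_le_pi (by linarith) (by linarith)
  have h3 : 0 ≤ Real.sin (t - r) := Real.sin_nonneg_of_nonneg_of_le_pi (by linarith) (by linarith)
  rw [hA, hB, hE] at hrel
  -- If the determinant is positive, `y` lies in the open cone over an interior point. Otherwise
  -- pairing the relation with `n` gives a nonpositive left side and a nonnegative right side, so
  -- all terms vanish, and `y` has the azimuth of `x` or of `z`.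
  rcases lt_or_ge 0 (det3 (x - o) (y - o) (z - o)) with hD | hD
  · refine not_interior_relation hc (mem_body_of_mem_star hxs) (mem_body_of_mem_star hzs) hys hD
      (a := m₁ * Real.sin (t - s)) (b := m₂ * Real.sin (s - r)) (e := m₃ * Real.sin (t - r))
      (by positivity) (by positivity) (by positivity) ?_
    rw [← hrel]; module
  · have h4 := congrArg (inner ℝ n) hrel
    simp only [inner_add_right, inner_smul_right] at h4
    have e1 : 0 ≤ m₁ * Real.sin (t - s) * -inner ℝ n (x - o) := 
      mul_nonneg (by positivity) (by linarith)
    have e2 : 0 ≤ m₂ * Real.sin (s - r) * -inner ℝ n (z - o) :=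
      mul_nonneg (by positivity) (by linarith)
    have e3 : 0 ≤ m₃ * Real.sin (t - r) * inner ℝ n (y - o) :=
      mul_nonneg (by positivity) (by linarith)
    have e4 := mul_nonneg (neg_nonneg.2 hD) hnw
    have e5 : m₂ * Real.sin (s - r) * -inner ℝ n (z - o) = 0 := by linarith
    have e6 : Real.sin (s - r) = 0 := by
      have : m₂ * -inner ℝ n (z - o) ≠ 0 := (mul_pos hm₂ (by linarith)).ne'
      have e7 : m₂ * -inner ℝ n (z - o) * Real.sin (s - r) = 0 := by linarith
      exact (mul_eq_zero.1 e7).resolve_left this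
    rcases eq_or_lt_of_le hrs with h5 | h5
    · subst h5
      exact not_opposite_of_hasLift hc hb hbo hxs hys hx hy hnx hny
    · have h6 : s = t := by
        by_contra hne
        have : s < t := lt_of_le_of_ne hst hne
        exact (Real.sin_pos_of_pos_of_lt_pi (show 0 < s - r by linarith) (by linarith)).ne' e6
      subst h6
      exact not_opposite_of_hasLift hc hb hbo hzs hys hz hy hnz hny

lemma HasLift.add_two_pi {x : E3} {t : ℝ} (h : HasLift V o b x t) :
    HasLift V o b x (t + 2 * Real.pi) := by
  obtain ⟨r, hr, h⟩ := h
  refine ⟨r, hr, ?_⟩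
  rw [h]
  push_cast
  rw [add_mul, Complex.exp_add, Complex.exp_two_pi_mul_I, mul_one]

lemma not_alternating_of_pos {x y z u n : E3} {q r s t : ℝ}
    (hc : V.centroid ℝ id ∈ interior (body V)) (hb : b ∈ star V o) (hbo : b ≠ o)
    (hxs : x ∈ star V o) (hys : y ∈ star V o) (hzs : z ∈ star V o) (hus : u ∈ star V o)
    (hx : HasLift V o b x q) (hy : HasLift V o b y r) (hz : HasLift V o b z s)
    (hu : HasLift V o b u t)
    (hqr : q ≤ r) (hrs : r ≤ s) (hst : s ≤ t) (htq : t ≤ q + 2 * Real.pi)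
    (hnx : inner ℝ n (x - o) < 0) (hny : 0 < inner ℝ n (y - o)) (hnz : inner ℝ n (z - o) < 0)
    (hnu : 0 < inner ℝ n (u - o)) : False := by
  have hpi := Real.pi_pos
  -- Of the two rays on the same side as the axis, one lies between its cyclic neighbours within a
  -- half-turn, as the two arcs between those neighbours add up to at most `2π`. If the axis is on
  -- the negative side, `n` is reversed.
  rcases le_total 0 (inner ℝ n (V.centroid ℝ id - o)) with hw | hw
  · by_cases h : s ≤ q + Real.pi
    · exact not_separated_middle hc hb hbo hxs hys hzs hx hy hz hqr hrs h hnx hny hnz hw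
    · push Not at h
      exact not_separated_middle hc hb hbo hzs hus hxs hz hu hx.add_two_pi hst htq (by linarith)
        hnz hnu hnx hw
  · have hneg : ∀ v, inner ℝ (-n) v = - inner ℝ n v := fun v => inner_neg_left _ _
    by_cases h : t ≤ r + Real.pi
    · refine not_separated_middle (n := -n) hc hb hbo hys hzs hus hy hz hu hrs hst h ?_ ?_ ?_ ?_
        <;> rw [hneg] <;> linarith
    · push Not at h
      refine not_separated_middle (n := -n) hc hb hbo hus hxs hys hu hx.add_two_pi
        hy.add_two_pi htq (by linarith) (by linarith) ?_ ?_ ?_ ?_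
        <;> rw [hneg] <;> linarith

/-- A plane through the apex does not have four rays of the boundary of a convex cone, in cyclic
order, on alternating sides. -/
lemma not_alternating {x y z u n : E3} {q r s t : ℝ}
    (hc : V.centroid ℝ id ∈ interior (body V)) (hb : b ∈ star V o) (hbo : b ≠ o)
    (hxs : x ∈ star V o) (hys : y ∈ star V o) (hzs : z ∈ star V o) (hus : u ∈ star V o)
    (hx : HasLift V o b x q) (hy : HasLift V o b y r) (hz : HasLift V o b z s)
    (hu : HasLift V o b u t)
    (hqr : q ≤ r) (hrs : r ≤ s) (hst : s ≤ t) (htq : t ≤ q + 2 * Real.pi)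
    (hxy : inner ℝ n (x - o) * inner ℝ n (y - o) < 0)
    (hyz : inner ℝ n (y - o) * inner ℝ n (z - o) < 0)
    (hzu : inner ℝ n (z - o) * inner ℝ n (u - o) < 0) : False := by
  rcases mul_neg_iff.1 hxy with ⟨h1, h2⟩ | ⟨h1, h2⟩
  · have h3 : 0 < inner ℝ n (z - o) := by
      by_contra h
      push Not at h
      linarith [mul_nonneg_of_nonpos_of_nonpos h2.le h]
    have h4 : inner ℝ n (u - o) < 0 := by
      by_contra h
      push Not at h
      linarith [mul_nonneg h3.le h]
    have hneg : ∀ v, inner ℝ (-n) v = - inner ℝ n v := fun v => inner_neg_left _ _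
    refine not_alternating_of_pos (n := -n) hc hb hbo hxs hys hzs hus hx hy hz hu hqr hrs hst htq
      ?_ ?_ ?_ ?_ <;> rw [hneg] <;> linarith
  · have h3 : inner ℝ n (z - o) < 0 := by
      by_contra h
      push Not at h
      linarith [mul_nonneg h2.le h]
    have h4 : 0 < inner ℝ n (u - o) := by
      by_contra h
      push Not at h
      linarith [mul_nonneg_of_nonpos_of_nonpos h3.le h]
    exact not_alternating_of_pos hc hb hbo hxs hys hzs hus hx hy hz hu hqr hrs hst htq h1 h2 h3 h4

/-- The total angle of a chain that leads once around the star of `o` is at most `2π`; it is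
smaller if the star lies on one side of many planes. -/
lemma sum_angle_star_le (hc : V.centroid ℝ id ∈ interior (body V)) (hb : b ∈ star V o)
    (hbo : b ≠ o) {N : ℕ} {x : ℕ → E3} {t : ℕ → ℝ}
    (hxs : ∀ j ≤ N, x j ∈ star V o ∧ x j ≠ o) (hx : ∀ j ≤ N, HasLift V o b (x j) (t j))
    (ht : ∀ j < N, t j ≤ t (j + 1)) (htN : t N ≤ t 0 + 2 * Real.pi)
    {U : Set E3} (hU : MeasurableSet U) (hUball : U ⊆ Metric.ball 0 1)
    (hUx : ∀ n ∈ U, ∀ y ∈ star V o, inner ℝ n (y - o) ≤ 0) :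
    ∑ j ∈ Finset.range N, EuclideanGeometry.angle (x j) o (x (j + 1))
      ≤ 2 * Real.pi * (1 - volume.real U / ballVolume) := by
  have hmono : ∀ i j, i ≤ j → j ≤ N → t i ≤ t j := by
    intro i j hij
    induction j, hij using Nat.le_induction with
    | base => intro _; exact le_rfl
    | succ j _ ih => intro h; exact (ih (by omega)).trans (ht j (by omega))
  refine sum_angle_le (x := fun j => x j - o) (fun j hj => sub_ne_zero.2 (hxs j hj).2) ?_ hU
    hUball ?_
  · intro n
    by_contra hcon
    push Not at hcon
    obtain ⟨i, j, k, l, hij, hjk, hkl, hlN, h1, h2, h3⟩ :=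
      exists_alternating (f := fun j => inner ℝ n (x j - o)) hcon
    exact not_alternating hc hb hbo (hxs i (by omega)).1 (hxs j (by omega)).1
      (hxs k (by omega)).1 (hxs l hlN).1 (hx i (by omega)) (hx j (by omega)) (hx k (by omega))
      (hx l hlN) (hmono _ _ hij.le (by omega)) (hmono _ _ hjk.le (by omega))
      (hmono _ _ hkl.le hlN)
      ((hmono l N hlN le_rfl).trans (htN.trans (by
        have := hmono 0 i (by omega) (by omega); linarith))) h1 h2 h3
  · intro n hn j hj
    exact mul_nonneg_of_nonpos_of_nonpos (hUx n hn _ (hxs j (by omega)).1)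
      (hUx n hn _ (hxs (j + 1) (by omega)).1)

end Star

/-! ### Arguments -/

lemma argIco_mem (z : ℂ) : argIco z ∈ Set.Ico 0 (2 * Real.pi) := by
  simpa [argIco] using toIcoMod_mem_Ico Real.two_pi_pos 0 z.arg

lemma argIoc_mem (z : ℂ) : argIoc z ∈ Set.Ioc 0 (2 * Real.pi) := by
  simpa [argIoc] using toIocMod_mem_Ioc Real.two_pi_pos 0 z.arg

lemma exp_argIco (z : ℂ) : (‖z‖ : ℂ) * Complex.exp (argIco z * Complex.I) = z := by
  conv_rhs => rw [← Complex.norm_mul_exp_arg_mul_I z]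
  congr 1
  rw [Complex.exp_eq_exp_iff_exists_int]
  refine ⟨-toIcoDiv Real.two_pi_pos 0 z.arg, ?_⟩
  rw [argIco, ← self_sub_toIcoDiv_zsmul]
  push_cast [zsmul_eq_mul]
  ring

lemma exp_argIoc (z : ℂ) : (‖z‖ : ℂ) * Complex.exp (argIoc z * Complex.I) = z := by
  conv_rhs => rw [← Complex.norm_mul_exp_arg_mul_I z]
  congr 1
  rw [Complex.exp_eq_exp_iff_exists_int]
  refine ⟨-toIocDiv Real.two_pi_pos 0 z.arg, ?_⟩
  rw [argIoc, ← self_sub_toIocDiv_zsmul]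
  push_cast [zsmul_eq_mul]
  ring

lemma eq_of_exp_eq {s t : ℝ} (h : Complex.exp (s * Complex.I) = Complex.exp (t * Complex.I))
    (hst : |s - t| < 2 * Real.pi) : s = t := by
  rw [Complex.exp_eq_exp_iff_exists_int] at h
  obtain ⟨n, hn⟩ := h
  have h1 : (s : ℂ) = ((t + n * (2 * Real.pi) : ℝ) : ℂ) := by
    have : (s : ℂ) * Complex.I = ((t + n * (2 * Real.pi) : ℝ) : ℂ) * Complex.I := by
      rw [hn]; push_cast; ring
    exact mul_right_cancel₀ Complex.I_ne_zero this
  have h2 : s = t + n * (2 * Real.pi) := by exact_mod_cast h1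
  have h3 : |(n : ℝ)| < 1 := by
    have e : s - t = n * (2 * Real.pi) := by rw [h2]; ring
    rw [e, abs_mul, abs_of_pos Real.two_pi_pos] at hst
    have := Real.two_pi_pos
    by_contra hc
    push Not at hc
    nlinarith
  have h4 : n = 0 := by
    have : |n| < 1 := by exact_mod_cast h3
    exact Int.abs_lt_one_iff.1 this
  rw [h2, h4]; simp

lemma argIoc_eq {r t : ℝ} (hr : 0 < r) (ht0 : 0 < t) (ht : t ≤ 2 * Real.pi) :
    argIoc (r * Complex.exp (t * Complex.I)) = t := by
  set z := (r : ℂ) * Complex.exp (t * Complex.I) with hz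
  have hn : ‖z‖ = r := by
    rw [hz, norm_mul, Complex.norm_exp_ofReal_mul_I, Complex.norm_real, Real.norm_eq_abs,
      abs_of_pos hr, mul_one]
  have h := exp_argIoc z
  have hm := argIoc_mem z
  rw [hn] at h
  refine eq_of_exp_eq (mul_left_cancel₀ (Complex.ofReal_ne_zero.2 hr.ne') (h.trans hz)) ?_
  rw [abs_lt]
  constructor <;> linarith [hm.1, hm.2]

/-! ### Bounds for angles in the surface -/

/-- The lengths of the chains that approximate an arc of the link. -/
def chainLengths (V : Finset E3) (a o b : E3) : Set ℝ :=
  {L : ℝ | ∃ (n : ℕ) (x : ℕ → E3),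
    x 0 = b ∧
    (∀ j ≤ n, x j ∈ star V o ∧ x j ≠ o) ∧
    (∀ j < n, argIco (azimuth V o b (x j)) ≤ argIco (azimuth V o b (x (j + 1)))) ∧
    argIco (azimuth V o b (x n)) ≤ argIoc (azimuth V o b a) ∧
    L = ∑ j ∈ Finset.range n, EuclideanGeometry.angle (x j) o (x (j + 1))
      + EuclideanGeometry.angle (x n) o a}

lemma surfaceAngle_eq (V : Finset E3) (a o b : E3) :
    surfaceAngle V a o b = sSup (chainLengths V a o b) := rfl

section

variable {V : Finset E3} {o a b : E3}

lemma hasLift_argIco (hc : V.centroid ℝ id ∈ interior (body V)) (hb : b ∈ star V o)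
    (hbo : b ≠ o) {x : E3} (hx : x ∈ star V o) (hxo : x ≠ o) :
    HasLift V o b x (argIco (azimuth V o b x)) :=
  ⟨_, norm_pos_iff.2 (azimuth_ne_zero hc hb hbo hx hxo), (exp_argIco _).symm⟩

lemma hasLift_argIoc (hc : V.centroid ℝ id ∈ interior (body V)) (hb : b ∈ star V o)
    (hbo : b ≠ o) {x : E3} (hx : x ∈ star V o) (hxo : x ≠ o) :
    HasLift V o b x (argIoc (azimuth V o b x)) :=
  ⟨_, norm_pos_iff.2 (azimuth_ne_zero hc hb hbo hx hxo), (exp_argIoc _).symm⟩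

lemma hasLift_self (hc : V.centroid ℝ id ∈ interior (body V)) (hb : b ∈ star V o)
    (hbo : b ≠ o) : HasLift V o b b 0 := by
  refine ⟨_, gram_pos hc hb hbo, ?_⟩
  rw [azimuth]
  apply Complex.ext
  · rw [rotation_re, gram, Complex.re_ofReal_mul, real_inner_self_eq_norm_sq]; simp; ring
  · rw [rotation_im, Complex.im_ofReal_mul]
    simp [det3_eq]
    right; ring

/-- The cocycle identity for `rotation`; it allows a chain based at `a` to be continued in the
coordinate based at `b`. -/
lemma HasLift.trans (hc : V.centroid ℝ id ∈ interior (body V)) (ha : a ∈ star V o)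
    (hao : a ≠ o) {x : E3} {s t : ℝ} (h₁ : HasLift V o b a s) (h₂ : HasLift V o a x t) :
    HasLift V o b x (s + t) := by
  obtain ⟨r, hr, h₁⟩ := h₁
  obtain ⟨r', hr', h₂⟩ := h₂
  have hg := gram_pos hc ha hao
  have h := rotation_mul_rotation (V.centroid ℝ id - o) (b - o) (a - o) (x - o)
  change azimuth V o b a * azimuth V o a x = _ * azimuth V o b x at h
  rw [h₁, h₂] at h
  refine ⟨r * r' / gram (V.centroid ℝ id - o) (a - o), by positivity, ?_⟩
  have hg' : (gram (V.centroid ℝ id - o) (a - o) : ℂ) ≠ 0 := Complex.ofReal_ne_zero.2 hg.ne'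
  refine mul_left_cancel₀ hg' (h.symm.trans ?_)
  push_cast
  rw [add_mul, Complex.exp_add]
  field_simp

/-- The two azimuths are conjugate. The plane with normal `n` excludes equal directions, for which
the sum would be `4π`. -/
lemma argIoc_azimuth_add (hc : V.centroid ℝ id ∈ interior (body V)) (ha : a ∈ star V o)
    (hao : a ≠ o) (hb : b ∈ star V o) (hbo : b ≠ o) {n : E3} (hna : inner ℝ n (a - o) < 0)
    (hnb : 0 < inner ℝ n (b - o)) :
    argIoc (azimuth V o b a) + argIoc (azimuth V o a b) = 2 * Real.pi := by
  have hm := argIoc_mem (azimuth V o b a)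
  have hl := hasLift_argIoc hc hb hbo ha hao
  set A := argIoc (azimuth V o b a) with hA
  have hne : A ≠ 2 * Real.pi := by
    intro h
    have h1 := (hasLift_self hc hb hbo).add_two_pi
    rw [zero_add, ← h] at h1
    exact not_opposite_of_hasLift hc hb hbo ha hb hl h1 hna hnb
  obtain ⟨r, hr, h⟩ := hl
  have h2 : azimuth V o a b = r * Complex.exp ((2 * Real.pi - A : ℝ) * Complex.I) := by
    have h3 : azimuth V o a b = (starRingEnd ℂ) (azimuth V o b a) := rotation_swap _ _ _
    rw [h3, h, map_mul, Complex.conj_ofReal, ← Complex.exp_conj, map_mul, Complex.conj_ofReal,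
      Complex.conj_I]
    have e : ((2 * Real.pi - A : ℝ) : ℂ) * Complex.I
        = (A : ℂ) * -Complex.I + 2 * Real.pi * Complex.I := by push_cast; ring
    rw [e, Complex.exp_add, Complex.exp_two_pi_mul_I, mul_one]
  rw [h2, argIoc_eq hr (by linarith [lt_of_le_of_ne hm.2 hne]) (by linarith [hm.1])]
  ring

lemma angle_mem_chainLengths (hb : b ∈ star V o) (hbo : b ≠ o)
    (hc : V.centroid ℝ id ∈ interior (body V)) :
    EuclideanGeometry.angle b o a ∈ chainLengths V a o b := by
  refine ⟨0, fun _ => b, rfl, fun _ _ => ⟨hb, hbo⟩, fun j hj => absurd hj (by omega), ?_, by simp⟩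
  have h : argIco (azimuth V o b b) = 0 := by
    obtain ⟨r, hr, h⟩ := hasLift_self hc hb hbo
    rw [h]
    simp only [Complex.ofReal_zero, zero_mul, Complex.exp_zero, mul_one, argIco,
      Complex.arg_ofReal_of_nonneg hr.le]
    simp
  rw [h]
  exact (argIoc_mem _).1.le

/-- A chain from `b` to `a` followed by one from `a` to `b` goes once around the star, so the bound
for closed chains applies, with `U` empty. -/
lemma add_le_of_mem_chainLengths (hc : V.centroid ℝ id ∈ interior (body V)) (ha : a ∈ star V o)
    (hao : a ≠ o) (hb : b ∈ star V o) (hbo : b ≠ o) {n : E3} (hna : inner ℝ n (a - o) < 0)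
    (hnb : 0 < inner ℝ n (b - o)) {L L' : ℝ} (hL : L ∈ chainLengths V a o b)
    (hL' : L' ∈ chainLengths V b o a) : L + L' ≤ 2 * Real.pi := by
  obtain ⟨n, x, hx0, hxs, hxt, hxn, rfl⟩ := hL
  obtain ⟨m, y, hy0, hys, hyt, hym, rfl⟩ := hL'
  have hsum := argIoc_azimuth_add hc ha hao hb hbo hna hnb
  set A := argIoc (azimuth V o b a) with hA
  have hlA : HasLift V o b a A := hasLift_argIoc hc hb hbo ha hao
  -- The `x j`, then the `y j` with azimuths shifted by `A`, then `b` again. The point `a` ending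
  -- the first chain is `y 0`, at index `n + 1`.
  set z : ℕ → E3 := fun j => if j ≤ n then x j else if j ≤ n + 1 + m then y (j - (n + 1)) else b
    with hz
  set t : ℕ → ℝ := fun j => if j ≤ n then argIco (azimuth V o b (x j)) else
    if j ≤ n + 1 + m then A + argIco (azimuth V o a (y (j - (n + 1))))
    else A + argIoc (azimuth V o a b) with ht
  have hz1 : ∀ j ≤ n, z j = x j := fun j hj => by simp [hz, hj]
  have hz2 : ∀ j ≤ m, z (n + 1 + j) = y j := fun j hj => by
    simp only [hz]
    rw [if_neg (by omega), if_pos (by omega), Nat.add_sub_cancel_left]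
  have hz3 : z (n + 1 + (m + 1)) = b := by
    simp only [hz]
    rw [if_neg (by omega), if_neg (by omega)]
  have ht1 : ∀ j ≤ n, t j = argIco (azimuth V o b (x j)) := fun j hj => by simp [ht, hj]
  have ht2 : ∀ j ≤ m, t (n + 1 + j) = A + argIco (azimuth V o a (y j)) := fun j hj => by
    simp only [ht]
    rw [if_neg (by omega), if_pos (by omega), Nat.add_sub_cancel_left]
  have ht3 : t (n + 1 + (m + 1)) = A + argIoc (azimuth V o a b) := by
    simp only [ht]
    rw [if_neg (by omega), if_neg (by omega)]
  have hcases : ∀ j ≤ n + 1 + (m + 1), j ≤ n ∨ (∃ i ≤ m, j = n + 1 + i) ∨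
      j = n + 1 + (m + 1) := by
    intro j hj
    by_cases h1 : j ≤ n
    · exact Or.inl h1
    · by_cases h2 : j ≤ n + 1 + m
      · exact Or.inr (Or.inl ⟨j - (n + 1), by omega, by omega⟩)
      · exact Or.inr (Or.inr (by omega))
  have key := sum_angle_star_le hc hb hbo (N := n + 1 + (m + 1)) (x := z) (t := t) ?_ ?_ ?_ ?_
    MeasurableSet.empty (Set.empty_subset _) (by simp)
  · rw [measureReal_empty, zero_div, sub_zero, mul_one, Finset.sum_range_add,
      Finset.sum_range_succ, Finset.sum_range_succ] at key
    have e1 : ∑ j ∈ Finset.range n, EuclideanGeometry.angle (z j) o (z (j + 1))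
        = ∑ j ∈ Finset.range n, EuclideanGeometry.angle (x j) o (x (j + 1)) := by
      refine Finset.sum_congr rfl fun j hj => ?_
      have := Finset.mem_range.1 hj
      rw [hz1 j (by omega), hz1 (j + 1) (by omega)]
    have e2 : ∑ j ∈ Finset.range m,
          EuclideanGeometry.angle (z (n + 1 + j)) o (z (n + 1 + j + 1))
        = ∑ j ∈ Finset.range m, EuclideanGeometry.angle (y j) o (y (j + 1)) := by
      refine Finset.sum_congr rfl fun j hj => ?_
      have := Finset.mem_range.1 hj
      rw [add_assoc (n + 1), hz2 j (by omega), hz2 (j + 1) (by omega)]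
    have e3 : z (n + 1) = a := by rw [← hy0]; exact hz2 0 (by omega)
    rw [e1, e2, hz1 n le_rfl, e3, hz2 m le_rfl, add_assoc (n + 1), hz3] at key
    exact key
  · intro j hj
    rcases hcases j hj with h | ⟨i, hi, rfl⟩ | rfl
    · rw [hz1 j h]; exact hxs j h
    · rw [hz2 i hi]; exact hys i hi
    · rw [hz3]; exact ⟨hb, hbo⟩
  · intro j hj
    rcases hcases j hj with h | ⟨i, hi, rfl⟩ | rfl
    · rw [hz1 j h, ht1 j h]; exact hasLift_argIco hc hb hbo (hxs j h).1 (hxs j h).2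
    · rw [hz2 i hi, ht2 i hi]
      exact hlA.trans hc ha hao (hasLift_argIco hc ha hao (hys i hi).1 (hys i hi).2)
    · rw [hz3, ht3]; exact hlA.trans hc ha hao (hasLift_argIoc hc ha hao hb hbo)
  · intro j hj
    rcases hcases j hj.le with h | ⟨i, hi, rfl⟩ | rfl
    · rcases eq_or_lt_of_le h with rfl | h'
      · rw [ht1 j le_rfl]
        have := ht2 0 (by omega)
        rw [add_zero] at this
        rw [this]
        linarith [(argIco_mem (azimuth V o a (y 0))).1]
      · rw [ht1 j h, ht1 (j + 1) h']; exact hxt j h'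
    · rcases eq_or_lt_of_le hi with rfl | h'
      · rw [ht2 i le_rfl, add_assoc (n + 1), ht3]; linarith
      · rw [ht2 i hi, add_assoc (n + 1), ht2 (i + 1) h']; linarith [hyt i h']
    · omega
  · rw [ht3, hsum, ht1 0 (Nat.zero_le _)]
    linarith [(argIco_mem (azimuth V o b (x 0))).1]

/-- Opposite angles at a point of the surface, and their sum. -/
lemma surfaceAngle_bounds (hV : (interior (body V)).Nonempty) (ha : a ∈ star V o)
    (hao : a ≠ o) (hb : b ∈ star V o) (hbo : b ≠ o) {n : E3} (hna : inner ℝ n (a - o) < 0)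
    (hnb : 0 < inner ℝ n (b - o)) :
    surfaceAngle V a o b + surfaceAngle V b o a ≤ 2 * Real.pi ∧
    EuclideanGeometry.angle a o b ≤ surfaceAngle V a o b ∧
    EuclideanGeometry.angle a o b ≤ surfaceAngle V b o a := by
  have hc := centroid_mem_interior hV
  have h1 := angle_mem_chainLengths (a := a) hb hbo hc
  have h2 := angle_mem_chainLengths (a := b) ha hao hc
  have hle := fun L (hL : L ∈ chainLengths V a o b) L' (hL' : L' ∈ chainLengths V b o a) =>
    add_le_of_mem_chainLengths hc ha hao hb hbo hna hnb hL hL'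
  rw [surfaceAngle_eq, surfaceAngle_eq]
  refine ⟨?_, ?_, ?_⟩
  · have h3 : ∀ L' ∈ chainLengths V b o a, sSup (chainLengths V a o b) ≤ 2 * Real.pi - L' :=
      fun L' hL' => csSup_le ⟨_, h1⟩ fun L hL => by linarith [hle L hL L' hL']
    have h4 : sSup (chainLengths V b o a) ≤ 2 * Real.pi - sSup (chainLengths V a o b) :=
      csSup_le ⟨_, h2⟩ fun L' hL' => by linarith [h3 L' hL']
    linarith
  · rw [EuclideanGeometry.angle_comm]
    exact le_csSup ⟨2 * Real.pi - EuclideanGeometry.angle a o b,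
      fun L hL => by linarith [hle L hL _ h2]⟩ h1
  · exact le_csSup ⟨2 * Real.pi - EuclideanGeometry.angle b o a,
      fun L hL => by linarith [hle _ h1 L hL]⟩ h2

/-- Appending `b` at the end closes the chain after at most one turn; at a vertex, `U` will consist
of normals of supporting planes. -/
lemma le_of_mem_chainLengths_self (hc : V.centroid ℝ id ∈ interior (body V)) (hb : b ∈ star V o)
    (hbo : b ≠ o) {U : Set E3} (hU : MeasurableSet U) (hUball : U ⊆ Metric.ball 0 1)
    (hUx : ∀ n ∈ U, ∀ y ∈ star V o, inner ℝ n (y - o) ≤ 0) {L : ℝ}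
    (hL : L ∈ chainLengths V b o b) :
    L ≤ 2 * Real.pi * (1 - volume.real U / ballVolume) := by
  obtain ⟨n, x, hx0, hxs, hxt, hxn, rfl⟩ := hL
  set z : ℕ → E3 := fun j => if j ≤ n then x j else b with hz
  set t : ℕ → ℝ := fun j => if j ≤ n then argIco (azimuth V o b (x j)) else
    argIoc (azimuth V o b b) with ht
  have hz1 : ∀ j ≤ n, z j = x j := fun j hj => by simp [hz, hj]
  have hz2 : z (n + 1) = b := by simp [hz]
  have ht1 : ∀ j ≤ n, t j = argIco (azimuth V o b (x j)) := fun j hj => by simp [ht, hj]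
  have ht2 : t (n + 1) = argIoc (azimuth V o b b) := by simp [ht]
  have key := sum_angle_star_le hc hb hbo (N := n + 1) (x := z) (t := t) ?_ ?_ ?_ ?_
    hU hUball hUx
  · rw [Finset.sum_range_succ] at key
    have e1 : ∑ j ∈ Finset.range n, EuclideanGeometry.angle (z j) o (z (j + 1))
        = ∑ j ∈ Finset.range n, EuclideanGeometry.angle (x j) o (x (j + 1)) := by
      refine Finset.sum_congr rfl fun j hj => ?_
      have := Finset.mem_range.1 hj
      rw [hz1 j (by omega), hz1 (j + 1) (by omega)]
    rw [e1, hz1 n le_rfl, hz2] at key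
    exact key
  · intro j hj
    rcases Nat.le_succ_iff.1 hj with h | rfl
    · rw [hz1 j h]; exact hxs j h
    · rw [hz2]; exact ⟨hb, hbo⟩
  · intro j hj
    rcases Nat.le_succ_iff.1 hj with h | rfl
    · rw [hz1 j h, ht1 j h]; exact hasLift_argIco hc hb hbo (hxs j h).1 (hxs j h).2
    · rw [hz2, ht2]; exact hasLift_argIoc hc hb hbo hb hbo
  · intro j hj
    rcases Nat.lt_succ_iff_lt_or_eq.1 hj with h | rfl
    · rw [ht1 j h.le, ht1 (j + 1) h]; exact hxt j h
    · rw [ht1 j le_rfl, ht2]; exact hxn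
  · rw [ht2, ht1 0 (Nat.zero_le _)]
    linarith [(argIco_mem (azimuth V o b (x 0))).1, (argIoc_mem (azimuth V o b b)).2]

/-- A vertex has a supporting plane that meets the polyhedron nowhere else. -/
lemma exists_strict_support (ho : IsVertex V o) :
    ∃ n : E3, ∀ v ∈ V, v ≠ o → inner ℝ n (v - o) < 0 := by
  have h := ((convex_body V).mem_extremePoints_iff_mem_sdiff_convexHull_sdiff.1 ho).2
  have hsub : convexHull ℝ ((V : Set E3) \ {o}) ⊆ convexHull ℝ (body V \ {o}) :=
    convexHull_mono (Set.sdiff_subset_sdiff_left (subset_convexHull ℝ _))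
  obtain ⟨f, u, hf, hu⟩ := geometric_hahn_banach_closed_point (convex_convexHull ℝ _)
    ((V.finite_toSet.sdiff.isCompact_convexHull (𝕜 := ℝ)).isClosed) fun h' => h (hsub h')
  refine ⟨(InnerProductSpace.toDual ℝ E3).symm f, fun v hv hvo => ?_⟩
  rw [InnerProductSpace.toDual_symm_apply, map_sub]
  linarith [hf v (subset_convexHull ℝ _ ⟨hv, hvo⟩)]

lemma inner_sub_le_of_mem_body {n : E3} (hn : ∀ v ∈ V, inner ℝ n (v - o) ≤ 0) {x : E3}
    (hx : x ∈ body V) : inner ℝ n (x - o) ≤ 0 := by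
  have hcv : Convex ℝ {y : E3 | inner ℝ n y ≤ inner ℝ n o} :=
    convex_halfSpace_le (innerₛₗ ℝ n).isLinear _
  have : x ∈ {y : E3 | inner ℝ n y ≤ inner ℝ n o} := by
    refine convexHull_min (fun v hv => ?_) hcv hx
    have := hn v hv
    rw [inner_sub_right] at this
    exact sub_nonpos.1 this
  rw [inner_sub_right]
  exact sub_nonpos.2 this

/-- The total angle at a vertex is smaller than `2π`. -/
lemma surfaceAngle_self_bounds (hV : (interior (body V)).Nonempty) (ho : IsVertex V o)
    (hb : b ∈ star V o) (hbo : b ≠ o) :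
    surfaceAngle V b o b < 2 * Real.pi ∧
    ∀ c ∈ star V o, c ≠ o → 2 * EuclideanGeometry.angle b o c ≤ surfaceAngle V b o b := by
  have hc := centroid_mem_interior hV
  -- The normals of the planes that support the body only at `o`: a nonempty open set, whose
  -- positive volume is the gain over `2π`.
  set U : Set E3 := Metric.ball 0 1 ∩ ⋂ v ∈ V.filter (· ≠ o), {n : E3 | inner ℝ n (v - o) < 0}
    with hUdef
  have hUopen : IsOpen U := by
    refine Metric.isOpen_ball.inter (isOpen_biInter_finset fun v _ => ?_)
    exact isOpen_lt (by fun_prop) continuous_const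
  have hUne : U.Nonempty := by
    obtain ⟨n, hn⟩ := exists_strict_support ho
    refine ⟨(‖n‖ + 1)⁻¹ • n, ?_, ?_⟩
    · rw [mem_ball_zero_iff, norm_smul, norm_inv, Real.norm_of_nonneg (by positivity),
        inv_mul_lt_one₀ (by positivity)]
      linarith
    · simp only [Set.mem_iInter, Finset.mem_filter, Set.mem_ofPred_eq]
      intro v hv
      rw [inner_smul_left]
      exact mul_neg_of_pos_of_neg (by simp; positivity) (hn v hv.1 hv.2)
  have hUx : ∀ n ∈ U, ∀ y ∈ star V o, inner ℝ n (y - o) ≤ 0 := by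
    rintro n ⟨_, hn⟩ y hy
    refine inner_sub_le_of_mem_body (fun v hv => ?_) (mem_body_of_mem_star hy)
    by_cases hvo : v = o
    · simp [hvo]
    · simp only [Set.mem_iInter, Finset.mem_filter, Set.mem_ofPred_eq] at hn
      exact (hn v ⟨hv, hvo⟩).le
  have hUpos : 0 < volume.real U := by
    refine ENNReal.toReal_pos (hUopen.measure_pos volume hUne).ne' ?_
    exact ((measure_mono Set.inter_subset_left).trans_lt measure_ball_lt_top).ne
  have hle := fun L (hL : L ∈ chainLengths V b o b) =>
    le_of_mem_chainLengths_self hc hb hbo hUopen.measurableSet Set.inter_subset_left hUx hL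
  rw [surfaceAngle_eq]
  refine ⟨lt_of_le_of_lt (csSup_le ⟨_, angle_mem_chainLengths hb hbo hc⟩ hle) ?_, ?_⟩
  · have h1 : 0 < volume.real U / ballVolume := div_pos hUpos ballVolume_pos
    nlinarith [Real.pi_pos]
  · intro c hcs hco
    refine le_csSup ⟨_, hle⟩ ?_
    have hbb : azimuth V o b b = ((azimuth V o b b).re : ℂ) ∧ 0 ≤ (azimuth V o b b).re := by
      obtain ⟨r, hr, h⟩ := hasLift_self hc hb hbo
      rw [h]; simp [hr.le]
    have h0 : argIco (azimuth V o b b) = 0 := by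
      rw [hbb.1, argIco, Complex.arg_ofReal_of_nonneg hbb.2]; simp
    have h1 : argIoc (azimuth V o b b) = 2 * Real.pi := by
      rw [hbb.1, argIoc, Complex.arg_ofReal_of_nonneg hbb.2]; simp
    -- The chain `b, c, b` is admissible, since the final `b` is counted with azimuth `2π`.
    refine ⟨1, fun j => if j = 0 then b else c, by simp, ?_, ?_, ?_, ?_⟩
    · intro j _
      by_cases hj : j = 0 <;> simp [hj, hb, hbo, hcs, hco]
    · intro j hj
      have : j = 0 := by omega
      subst this
      simp only [if_true, h0]
      exact (argIco_mem _).1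
    · rw [h1]; exact (argIco_mem _).2.le
    · simp [EuclideanGeometry.angle_comm c o b]; ring

/-- From a vertex that does not maximize a linear function there leads an edge along which the
function grows. -/
lemma exists_mem_star_inner_pos (ho : IsVertex V o) {e : E3}
    (hpos : ∃ v ∈ V, 0 < inner ℝ e (v - o)) (hneg : ∃ v ∈ V, inner ℝ e (v - o) < 0) :
    ∃ c ∈ star V o, 0 < inner ℝ e (c - o) := by
  obtain ⟨n, hn⟩ := exists_strict_support ho
  obtain ⟨v₀, hv₀, hpos⟩ := hpos
  obtain ⟨v₁, hv₁, hneg⟩ := hneg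
  -- A pivot step: the supporting plane with normal `n` is tilted towards `e` until it first touches
  -- a spanning point `c` on the side where `e` grows.
  obtain ⟨c, hcV, hmin⟩ := (V.filter fun v => 0 < inner ℝ e (v - o)).exists_min_image
    (fun v => -inner ℝ n (v - o) / inner ℝ e (v - o))
    ⟨v₀, Finset.mem_filter.2 ⟨hv₀, hpos⟩⟩
  rw [Finset.mem_filter] at hcV
  obtain ⟨hcV, hce⟩ := hcV
  set μ := -inner ℝ n (c - o) / inner ℝ e (c - o) with hμ
  have hco : c ≠ o := by rintro rfl; simp at hce
  have hμpos : 0 < μ := div_pos (by linarith [hn c hcV hco]) hce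
  set p := n + μ • e with hp
  have hpin : ∀ y, inner ℝ p y = inner ℝ n y + μ * inner ℝ e y := fun y => by
    rw [hp, inner_add_left, inner_smul_left]; simp
  have hple : ∀ v ∈ V, inner ℝ p (v - o) ≤ 0 := by
    intro v hv
    rw [hpin]
    rcases lt_or_ge 0 (inner ℝ e (v - o)) with h | h
    · have := hmin v (Finset.mem_filter.2 ⟨hv, h⟩)
      rw [le_div_iff₀ h] at this
      linarith
    · by_cases hvo : v = o
      · simp [hvo]
      · linarith [hn v hv hvo, mul_nonneg hμpos.le (neg_nonneg.2 h)]
  have hpc : inner ℝ p (c - o) = 0 := by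
    rw [hpin, hμ, div_mul_cancel₀ _ hce.ne']; ring
  have hpv₁ : inner ℝ p (v₁ - o) < 0 := by
    have : v₁ ≠ o := by rintro rfl; simp at hneg
    rw [hpin]
    linarith [hn v₁ hv₁ this, mul_pos hμpos (neg_pos.2 hneg)]
  refine ⟨c, fun x hx => ?_, hce⟩
  have hxb : x ∈ body V :=
    (convex_body V).segment_subset ho.1 (subset_convexHull ℝ _ hcV) hx
  have hpx : inner ℝ p (x - o) = 0 := by
    rw [segment_eq_image'] at hx
    obtain ⟨s, _, rfl⟩ := hx
    simp only [add_sub_cancel_left]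
    rw [inner_smul_right, hpc, mul_zero]
  refine ⟨subset_closure hxb, fun hint => ?_⟩
  -- Moving `x` away from `v₁`, which lies strictly below the tilted plane, crosses that plane at
  -- once; so `x` is not interior.
  have hcont : Filter.Tendsto (fun s : ℝ => x + s • (x - v₁)) (nhdsWithin 0 (Set.Ioi 0))
      (nhds x) := by
    have : Continuous fun s : ℝ => x + s • (x - v₁) := by fun_prop
    have h := this.tendsto 0
    simp only [zero_smul, add_zero] at h
    exact h.mono_left nhdsWithin_le_nhds
  obtain ⟨s, hs, hs0⟩ := ((hcont.eventually (isOpen_interior.mem_nhds hint)).and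
    self_mem_nhdsWithin).exists
  have h1 := inner_sub_le_of_mem_body hple (interior_subset hs)
  have e1 : x + s • (x - v₁) - o = (x - o) + s • ((x - o) - (v₁ - o)) := by
    simp only [sub_sub_sub_cancel_right]; abel
  rw [e1, inner_add_right p (x - o), inner_smul_right, inner_sub_right p (x - o), hpx] at h1
  have hs0' : 0 < s := hs0
  nlinarith [mul_pos hs0' (neg_pos.2 hpv₁)]

end

/-! ### Stretching -/

lemma stretch_apply_zero (s : ℝ) (x : E3) : stretch s x 0 = x 0 / s := rfl
lemma stretch_apply_one (s : ℝ) (x : E3) : stretch s x 1 = x 1 / s := rfl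
lemma stretch_apply_two (s : ℝ) (x : E3) : stretch s x 2 = x 2 := rfl

lemma height_stretch (s : ℝ) (x : E3) : height (stretch s x) = height x := rfl

lemma ext_coordinates {x y : E3} (h0 : x 0 = y 0) (h1 : x 1 = y 1) (h2 : x 2 = y 2) : x = y := by
  ext i
  fin_cases i
  · exact h0
  · exact h1
  · exact h2

/-- The stretching as a linear automorphism. -/
noncomputable def stretchEquiv (s : ℝ) (hs : s ≠ 0) : E3 ≃L[ℝ] E3 :=
  LinearEquiv.toContinuousLinearEquiv
    { toFun := stretch s
      invFun := stretch s⁻¹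
      map_add' := fun x y => by
        apply ext_coordinates <;>
          simp only [stretch_apply_zero, stretch_apply_one, stretch_apply_two, PiLp.add_apply,
            add_div]
      map_smul' := fun r x => by
        apply ext_coordinates <;>
          simp only [stretch_apply_zero, stretch_apply_one, stretch_apply_two, PiLp.smul_apply,
            smul_eq_mul, RingHom.id_apply, mul_div_assoc]
      left_inv := fun x => by
        apply ext_coordinates <;>
          simp only [stretch_apply_zero, stretch_apply_one, stretch_apply_two] <;> field_simp
      right_inv := fun x => by
        apply ext_coordinates <;>
          simp only [stretch_apply_zero, stretch_apply_one, stretch_apply_two] <;> field_simp }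

lemma coe_stretchEquiv (s : ℝ) (hs : s ≠ 0) : ⇑(stretchEquiv s hs) = stretch s := rfl

section

variable {V : Finset E3} {s : ℝ}

lemma stretch_injective (hs : s ≠ 0) : Function.Injective (stretch s) :=
  (stretchEquiv s hs).injective

lemma body_stretchPoints (hs : s ≠ 0) : body (stretchPoints s V) = stretch s '' body V := by
  have := (stretchEquiv s hs).toLinearMap.image_convexHull (V : Set E3)
  unfold body stretchPoints
  rw [Finset.coe_image]
  exact this.symm

lemma surface_stretchPoints (hs : s ≠ 0) :
    surface (stretchPoints s V) = stretch s '' surface V := by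
  rw [surface, body_stretchPoints hs]
  exact ((stretchEquiv s hs).toHomeomorph.image_frontier _).symm

lemma segment_stretch (hs : s ≠ 0) (x y : E3) :
    segment ℝ (stretch s x) (stretch s y) = stretch s '' segment ℝ x y :=
  (image_segment ℝ (stretchEquiv s hs).toLinearMap.toAffineMap x y).symm

lemma stretch_mem_star (hs : s ≠ 0) {o x : E3} (hx : x ∈ star V o) :
    stretch s x ∈ star (stretchPoints s V) (stretch s o) := by
  change segment ℝ _ _ ⊆ _
  rw [segment_stretch hs, surface_stretchPoints hs]
  exact Set.image_mono hx

lemma isVertex_stretch (hs : s ≠ 0) {o : E3} (ho : IsVertex V o) :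
    IsVertex (stretchPoints s V) (stretch s o) := by
  rw [IsVertex, body_stretchPoints hs]
  have := image_extremePoints (𝕜 := ℝ) (stretchEquiv s hs) (body V)
  rw [coe_stretchEquiv] at this
  rw [← this]
  exact Set.mem_image_of_mem _ ho

lemma interior_body_stretchPoints_nonempty (hs : s ≠ 0) (hV : (interior (body V)).Nonempty) :
    (interior (body (stretchPoints s V))).Nonempty := by
  rw [body_stretchPoints hs]
  have := (stretchEquiv s hs).toHomeomorph.image_interior (body V)
  exact (hV.image _).mono this.subset

end

lemma tendsto_stretch (x : E3) :
    Filter.Tendsto (fun s => stretch s x) Filter.atTop (nhds !₂[0, 0, x 2]) := by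
  have h : Filter.Tendsto (fun s : ℝ => ![x 0 / s, x 1 / s, x 2]) Filter.atTop
      (nhds ![0, 0, x 2]) := by
    rw [tendsto_pi_nhds]
    intro i
    fin_cases i
    · exact Filter.Tendsto.div_atTop tendsto_const_nhds Filter.tendsto_id
    · exact Filter.Tendsto.div_atTop tendsto_const_nhds Filter.tendsto_id
    · exact tendsto_const_nhds
  exact ((PiLp.continuous_toLp 2 _).tendsto _).comp h

/-- The direction of the axis along which heights are measured. -/
noncomputable def vertical : E3 := !₂[0, 0, 1]

lemma inner_vertical (x : E3) : inner ℝ vertical x = height x := by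
  simp [inner_eq_coordinates, vertical, height]

lemma inner_vertical_sub (x y : E3) : inner ℝ vertical (x - y) = height x - height y := by
  rw [inner_sub_right, inner_vertical, inner_vertical]

lemma angle_eq_pi_of_vertical {p q : E3} (hp0 : p 0 = 0) (hp1 : p 1 = 0) (hq0 : q 0 = 0)
    (hq1 : q 1 = 0) (h : p 2 * q 2 < 0) : InnerProductGeometry.angle p q = Real.pi := by
  have hp2 : p 2 ≠ 0 := fun h0 => by simp [h0] at h
  rw [InnerProductGeometry.angle_eq_pi_iff]
  refine ⟨fun h0 => hp2 (by rw [h0]; rfl), q 2 / p 2, ?_, ?_⟩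
  · rw [div_neg_iff]
    rcases mul_neg_iff.1 h with h | h
    · exact Or.inr ⟨h.2, h.1⟩
    · exact Or.inl ⟨h.2, h.1⟩
  · apply ext_coordinates
    · rw [PiLp.smul_apply, hp0, hq0, smul_zero]
    · rw [PiLp.smul_apply, hp1, hq1, smul_zero]
    · rw [PiLp.smul_apply, smul_eq_mul, div_mul_cancel₀ _ hp2]

lemma tendsto_angle {p q : E3} (hp : p ≠ 0) (hq : q ≠ 0) {f g : ℝ → E3}
    (hf : Filter.Tendsto f Filter.atTop (nhds p)) (hg : Filter.Tendsto g Filter.atTop (nhds q)) :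
    Filter.Tendsto (fun s => InnerProductGeometry.angle (f s) (g s)) Filter.atTop
      (nhds (InnerProductGeometry.angle p q)) := by
  have h1 : Filter.Tendsto (fun s => (inner ℝ (f s) (g s) : ℝ)) Filter.atTop
      (nhds (inner ℝ p q)) := hf.inner hg
  have h2 : Filter.Tendsto (fun s => ‖f s‖ * ‖g s‖) Filter.atTop (nhds (‖p‖ * ‖q‖)) :=
    hf.norm.mul hg.norm
  have h3 : ‖p‖ * ‖q‖ ≠ 0 := mul_ne_zero (norm_ne_zero_iff.2 hp) (norm_ne_zero_iff.2 hq)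
  exact (Real.continuous_arccos.tendsto _).comp (h1.div h2 h3)

/-- In the limit the horizontal components vanish, and the two directions become vertical and
opposite. -/
lemma tendsto_angle_stretch {a o b : E3}
    (h : (height a - height o) * (height b - height o) < 0) :
    Filter.Tendsto (fun s => EuclideanGeometry.angle (stretch s a) (stretch s o) (stretch s b))
      Filter.atTop (nhds Real.pi) := by
  have hlim : ∀ x : E3, ∃ p : E3, p 0 = 0 ∧ p 1 = 0 ∧ p 2 = height x - height o ∧
      Filter.Tendsto (fun s => stretch s x - stretch s o) Filter.atTop (nhds p) :=
    fun x => ⟨!₂[0, 0, x 2] - !₂[0, 0, o 2], sub_self 0, sub_self 0, rfl,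
      (tendsto_stretch x).sub (tendsto_stretch o)⟩
  obtain ⟨p, hp0, hp1, hp2, hp⟩ := hlim a
  obtain ⟨q, hq0, hq1, hq2, hq⟩ := hlim b
  rw [← hp2, ← hq2] at h
  rw [← angle_eq_pi_of_vertical hp0 hp1 hq0 hq1 h]
  refine tendsto_angle ?_ ?_ hp hq
  · rintro rfl
    simp at h
  · rintro rfl
    simp at h

/-! ### Limits of the surface angles under stretching -/

section

variable {V : Finset E3} {a o b : E3}

/-- Opposite angles of the stretched polyhedron tend to `π`, and their sum is at most `2π`. -/
lemma eventually_surfaceAngle_stretch (hV : (interior (body V)).Nonempty) (ha : a ∈ star V o)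
    (hb : b ∈ star V o) (h : (height a - height o) * (height b - height o) < 0) {ε : ℝ}
    (hε : 0 < ε) : ∀ᶠ s : ℝ in Filter.atTop,
      surfaceAngle (stretchPoints s V) (stretch s a) (stretch s o) (stretch s b)
        + surfaceAngle (stretchPoints s V) (stretch s b) (stretch s o) (stretch s a)
        ≤ 2 * Real.pi ∧
      |surfaceAngle (stretchPoints s V) (stretch s a) (stretch s o) (stretch s b) - Real.pi| < ε ∧
      |surfaceAngle (stretchPoints s V) (stretch s b) (stretch s o) (stretch s a) - Real.pi|
        < ε := by
  have h1 := (tendsto_angle_stretch h).eventually (lt_mem_nhds (show Real.pi - ε < Real.pi by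
    linarith))
  filter_upwards [h1, Filter.eventually_gt_atTop 0] with s h1 hs
  have hs' := hs.ne'
  have hao : a ≠ o := by rintro rfl; simp at h
  have hbo : b ≠ o := by rintro rfl; simp at h
  have hao' : stretch s a ≠ stretch s o := fun h => hao (stretch_injective hs' h)
  have hbo' : stretch s b ≠ stretch s o := fun h => hbo (stretch_injective hs' h)
  have hV' := interior_body_stretchPoints_nonempty hs' hV
  have ha' := stretch_mem_star hs' ha
  have hb' := stretch_mem_star hs' hb
  have key : surfaceAngle (stretchPoints s V) (stretch s a) (stretch s o) (stretch s b)
        + surfaceAngle (stretchPoints s V) (stretch s b) (stretch s o) (stretch s a)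
        ≤ 2 * Real.pi ∧
      EuclideanGeometry.angle (stretch s a) (stretch s o) (stretch s b) ≤
        surfaceAngle (stretchPoints s V) (stretch s a) (stretch s o) (stretch s b) ∧
      EuclideanGeometry.angle (stretch s a) (stretch s o) (stretch s b) ≤
        surfaceAngle (stretchPoints s V) (stretch s b) (stretch s o) (stretch s a) := by
    have e : ∀ x, inner ℝ (-vertical) x = - inner ℝ vertical x := fun x => inner_neg_left _ _
    -- The horizontal plane through `o` separates `a` from `b`, which provides the normal.
    rcases mul_neg_iff.1 h with ⟨h2, h3⟩ | ⟨h2, h3⟩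
    · exact surfaceAngle_bounds (n := -vertical) hV' ha' hao' hb' hbo'
        (by rw [e, inner_vertical_sub, height_stretch, height_stretch]; linarith)
        (by rw [e, inner_vertical_sub, height_stretch, height_stretch]; linarith)
    · exact surfaceAngle_bounds (n := vertical) hV' ha' hao' hb' hbo'
        (by rw [inner_vertical_sub, height_stretch, height_stretch]; linarith)
        (by rw [inner_vertical_sub, height_stretch, height_stretch]; linarith)
  obtain ⟨k1, k2, k3⟩ := key
  refine ⟨k1, ?_, ?_⟩ <;> rw [abs_lt] <;> constructor <;> linarith

/-- A linear function that exceeds its value at `o` somewhere on the body does so at a spanning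
point; heights and negated heights then both grow along some edge at `o`. -/
lemma exists_mem_star_height {t c : E3} (ht : IsTop V t) (hc : IsBottom V c)
    (ho : IsVertex V o) (hos : o ∈ surface V) (hot : o ≠ t) (hoc : o ≠ c) :
    (∃ y ∈ star V o, height o < height y) ∧ ∃ y ∈ star V o, height y < height o := by
  have h1 := ht.2 o hos hot
  have h2 := hc.2 o hos hoc
  have hup : ∃ v ∈ V, 0 < inner ℝ vertical (v - o) := by
    by_contra hcon
    push Not at hcon
    have := inner_sub_le_of_mem_body hcon (surface_subset_body V ht.1)
    rw [inner_vertical_sub] at this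
    linarith
  have e : ∀ x, inner ℝ (-vertical) x = - inner ℝ vertical x := fun x => inner_neg_left _ _
  have hdown : ∃ v ∈ V, inner ℝ vertical (v - o) < 0 := by
    by_contra hcon
    push Not at hcon
    have := inner_sub_le_of_mem_body (n := -vertical) (o := o)
      (fun v hv => by rw [e]; linarith [hcon v hv]) (surface_subset_body V hc.1)
    rw [e, inner_vertical_sub] at this
    linarith
  constructor
  · obtain ⟨y, hy, h⟩ := exists_mem_star_inner_pos ho hup hdown
    rw [inner_vertical_sub] at h
    exact ⟨y, hy, by linarith⟩
  · obtain ⟨v, hv, h3⟩ := hup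
    obtain ⟨w, hw, h4⟩ := hdown
    obtain ⟨y, hy, h⟩ := exists_mem_star_inner_pos (e := -vertical) ho
      ⟨w, hw, by rw [e]; linarith⟩ ⟨v, hv, by rw [e]; linarith⟩
    rw [e, inner_vertical_sub] at h
    exact ⟨y, hy, by linarith⟩

/-- The total angle at a stretched vertex, other than the top and the bottom, tends to `2π` and is
smaller than `2π`. -/
lemma eventually_surfaceAngle_stretch_self (hV : (interior (body V)).Nonempty) {t c : E3}
    (ht : IsTop V t) (hc : IsBottom V c) (ho : IsVertex V o) (hot : o ≠ t) (hoc : o ≠ c)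
    (ha : a ∈ star V o) (hao : height a ≠ height o) {ε : ℝ} (hε : 0 < ε) :
    ∀ᶠ s : ℝ in Filter.atTop,
      surfaceAngle (stretchPoints s V) (stretch s a) (stretch s o) (stretch s a)
        < 2 * Real.pi ∧
      2 * Real.pi - ε <
        surfaceAngle (stretchPoints s V) (stretch s a) (stretch s o) (stretch s a) := by
  obtain ⟨⟨y, hy, hoy⟩, z, hz, hoz⟩ := exists_mem_star_height ht hc ho
    (apex_mem_surface_of_mem_star ha) hot hoc
  obtain ⟨x, hx, h⟩ : ∃ x ∈ star V o, (height a - height o) * (height x - height o) < 0 := by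
    rcases lt_or_gt_of_ne hao with h | h
    · exact ⟨y, hy, mul_neg_of_neg_of_pos (by linarith) (by linarith)⟩
    · exact ⟨z, hz, mul_neg_of_pos_of_neg (by linarith) (by linarith)⟩
  -- Half of `ε`, because the total angle is compared with twice the angle towards `x`.
  have h1 := (tendsto_angle_stretch h).eventually
    (lt_mem_nhds (show Real.pi - ε / 2 < Real.pi by linarith))
  filter_upwards [h1, Filter.eventually_gt_atTop 0] with s h1 hs
  have hs' := hs.ne'
  have hao' : a ≠ o := by rintro rfl; simp at h
  have hxo : x ≠ o := by rintro rfl; simp at h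
  obtain ⟨k1, k2⟩ := surfaceAngle_self_bounds (interior_body_stretchPoints_nonempty hs' hV)
    (isVertex_stretch hs' ho) (stretch_mem_star hs' ha)
    (fun h => hao' (stretch_injective hs' h))
  have := k2 _ (stretch_mem_star hs' hx) (fun h => hxo (stretch_injective hs' h))
  exact ⟨k1, by linarith⟩

end

/-! ### Parametrized plane paths -/

/-- The real number in `[0, 1]` that is closest to `x`. -/
noncomputable def clamp (x : ℝ) : ℝ := max 0 (min 1 x)

lemma clamp_of_nonpos {x : ℝ} (h : x ≤ 0) : clamp x = 0 := by
  rw [clamp, min_eq_right (by linarith), max_eq_left h]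

lemma clamp_of_one_le {x : ℝ} (h : 1 ≤ x) : clamp x = 1 := by
  rw [clamp, min_eq_left h, max_eq_right zero_le_one]

lemma clamp_of_mem {x : ℝ} (h0 : 0 ≤ x) (h1 : x ≤ 1) : clamp x = x := by
  rw [clamp, min_eq_right h1, max_eq_right h0]

lemma clamp_mono {x y : ℝ} (h : x ≤ y) : clamp x ≤ clamp y :=
  max_le_max le_rfl (min_le_min le_rfl h)

lemma clamp_le_one (x : ℝ) : clamp x ≤ 1 := max_le zero_le_one (min_le_left _ _)

lemma clamp_one_sub (x : ℝ) : clamp (1 - x) = 1 - clamp x := by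
  rcases le_total x 0 with h | h
  · rw [clamp_of_nonpos h, clamp_of_one_le (by linarith), sub_zero]
  · rcases le_total x 1 with h' | h'
    · rw [clamp_of_mem h h', clamp_of_mem (by linarith) (by linarith)]
    · rw [clamp_of_one_le h', clamp_of_nonpos (by linarith), sub_self]

/-- The path `[g 0, …, g m]`, parametrized by `[0, m]`. -/
noncomputable def pathPoint (m : ℕ) (g : ℕ → ℂ) (t : ℝ) : ℂ :=
  g 0 + ∑ i ∈ Finset.range m, clamp (t - i) • (g (i + 1) - g i)

section

variable {m : ℕ} {g : ℕ → ℂ}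

/-- On edge `i` the clamps of earlier edges are `1` and those of later edges `0`. Writing the path
as a clamped sum of edges makes linear functions along it sums of monotone terms. -/
lemma pathPoint_add {i : ℕ} (hi : i < m) {t : ℝ} (h0 : 0 ≤ t) (h1 : t ≤ 1) :
    pathPoint m g (i + t) = g i + t • (g (i + 1) - g i) := by
  obtain ⟨d, rfl⟩ : ∃ d, m = i + (d + 1) := ⟨m - i - 1, by omega⟩
  rw [pathPoint, Finset.sum_range_add, Finset.sum_range_succ']
  have e1 : ∑ j ∈ Finset.range i, clamp (i + t - j) • (g (j + 1) - g j) = g i - g 0 := by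
    rw [← Finset.sum_range_sub]
    refine Finset.sum_congr rfl fun j hj => ?_
    have h : ((j + 1 : ℕ) : ℝ) ≤ i := by exact_mod_cast Finset.mem_range.1 hj
    push_cast at h
    rw [clamp_of_one_le (by linarith), one_smul]
  have e2 : ∑ j ∈ Finset.range d, clamp (i + t - ((i + (j + 1) : ℕ) : ℝ)) •
      (g (i + (j + 1) + 1) - g (i + (j + 1))) = 0 := by
    refine Finset.sum_eq_zero fun j _ => ?_
    have h : (0 : ℝ) ≤ j := Nat.cast_nonneg j
    push_cast
    rw [clamp_of_nonpos (by linarith), zero_smul]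
  rw [e1, e2, add_zero, add_sub_cancel_left, clamp_of_mem h0 h1, zero_add]
  ring

lemma pathPoint_natCast {i : ℕ} (hi : i ≤ m) : pathPoint m g i = g i := by
  rcases eq_or_lt_of_le hi with rfl | h
  · rcases i with _ | i
    · simp [pathPoint]
    · have := pathPoint_add (g := g) (Nat.lt_succ_self i) zero_le_one le_rfl
      push_cast
      rw [this, one_smul]
      ring
  · have := pathPoint_add (g := g) h le_rfl zero_le_one
    rwa [add_zero, zero_smul, add_zero] at this

lemma exists_pathPoint_of_mem_segment {i : ℕ} (hi : i < m) {x : ℂ}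
    (hx : x ∈ segment ℝ (g i) (g (i + 1))) :
    ∃ t : ℝ, i ≤ t ∧ t ≤ i + 1 ∧ pathPoint m g t = x := by
  rw [segment_eq_image'] at hx
  obtain ⟨t, ⟨h0, h1⟩, rfl⟩ := hx
  exact ⟨i + t, by linarith, by linarith, pathPoint_add hi h0 h1⟩

lemma exists_pathPoint_of_mem_trace {x : ℂ} (hx : x ∈ trace m g) :
    ∃ t : ℝ, 0 ≤ t ∧ t ≤ m ∧ pathPoint m g t = x := by
  simp only [trace, Set.mem_iUnion] at hx
  obtain ⟨i, hi, hx⟩ := hx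
  obtain ⟨t, h0, h1, h⟩ := exists_pathPoint_of_mem_segment hi hx
  have h2 : ((i + 1 : ℕ) : ℝ) ≤ m := by exact_mod_cast hi
  push_cast at h2
  exact ⟨t, by linarith [(Nat.cast_nonneg i : (0 : ℝ) ≤ i)], by linarith, h⟩

lemma isSimplePath_of_injOn (h : Set.InjOn (pathPoint m g) (Set.Icc 0 m)) :
    IsSimplePath m g := by
  have hcast : ∀ i : ℕ, (0 : ℝ) ≤ i := fun i => Nat.cast_nonneg i
  constructor
  · intro i hi
    refine Set.Subset.antisymm ?_ ?_
    · rintro x ⟨hx1, hx2⟩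
      obtain ⟨t, h0, h1, ht⟩ := exists_pathPoint_of_mem_segment (m := m) (by omega) hx1
      obtain ⟨t', h0', h1', ht'⟩ := exists_pathPoint_of_mem_segment (m := m) hi hx2
      have hm : ((i + 1 + 1 : ℕ) : ℝ) ≤ m := by exact_mod_cast hi
      push_cast at hm h0' h1'
      have := h ⟨by linarith [hcast i], by linarith⟩ ⟨by linarith [hcast i], by linarith⟩
        (ht.trans ht'.symm)
      have h2 : t = (i + 1 : ℕ) := by push_cast; linarith
      rw [Set.mem_singleton_iff, ← ht, h2, pathPoint_natCast hi.le]
    · rintro x rfl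
      exact ⟨right_mem_segment _ _ _, left_mem_segment _ _ _⟩
  · intro i j hij hj
    rw [Set.disjoint_left]
    intro x hx1 hx2
    obtain ⟨t, h0, h1, ht⟩ := exists_pathPoint_of_mem_segment (m := m) (by omega) hx1
    obtain ⟨t', h0', h1', ht'⟩ := exists_pathPoint_of_mem_segment (m := m) hj hx2
    have hm : ((j + 1 : ℕ) : ℝ) ≤ m := by exact_mod_cast hj
    have hm' : ((i + 1 + 1 : ℕ) : ℝ) ≤ j := by exact_mod_cast hij
    push_cast at hm hm'
    have := h ⟨by linarith [hcast i], by linarith⟩ ⟨by linarith [hcast j], by linarith⟩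
      (ht.trans ht'.symm)
    linarith

/-- A linear function that grows along the edges with indices in `[a, b)` grows along the path. -/
lemma pathPoint_strictMono {a b : ℕ} (hbm : b ≤ m) {f : ℂ →ₗ[ℝ] ℝ}
    (hf : ∀ i, a ≤ i → i < b → 0 < f (g (i + 1) - g i)) {s t : ℝ} (has : a ≤ s) (hst : s < t)
    (htb : t ≤ b) : f (pathPoint m g s) < f (pathPoint m g t) := by
  have hs0 : 0 ≤ s := le_trans (Nat.cast_nonneg a) has
  simp only [pathPoint, map_add, map_sum, map_smul, smul_eq_mul]
  rw [add_lt_add_iff_left]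
  -- The term that grows strictly belongs to the edge on which the path leaves the point with
  -- parameter `s`.
  refine Finset.sum_lt_sum (fun i _ => ?_) ⟨⌊s⌋₊, ?_, ?_⟩
  · by_cases h1 : a ≤ i
    · by_cases h2 : i < b
      · exact mul_le_mul_of_nonneg_right (clamp_mono (by linarith)) (hf i h1 h2).le
      · have : (b : ℝ) ≤ i := by exact_mod_cast not_lt.1 h2
        rw [clamp_of_nonpos (by linarith), clamp_of_nonpos (by linarith)]
    · have : ((i + 1 : ℕ) : ℝ) ≤ a := by exact_mod_cast not_le.1 h1
      push_cast at this
      rw [clamp_of_one_le (by linarith), clamp_of_one_le (by linarith)]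
  · have : ⌊s⌋₊ < b := (Nat.floor_lt hs0).2 (by linarith)
    exact Finset.mem_range.2 (by omega)
  · have h1 : a ≤ ⌊s⌋₊ := Nat.le_floor has
    have h2 : ⌊s⌋₊ < b := (Nat.floor_lt hs0).2 (by linarith)
    refine mul_lt_mul_of_pos_right ?_ (hf _ h1 h2)
    have h3 := Nat.floor_le hs0
    have h4 := Nat.lt_floor_add_one s
    rw [clamp_of_mem (x := s - ⌊s⌋₊) (by linarith) (by linarith)]
    rcases le_total (t - ⌊s⌋₊) 1 with h | h
    · rw [clamp_of_mem (by linarith) h]; linarith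
    · rw [clamp_of_one_le h]; linarith

end

/-! ### Hairpins -/

section

variable {k : ℕ} {g : ℕ → ℂ}

/-- A linear function that grows along the sums of opposite edges of a path with `2 * k` edges
separates opposite points of the path. -/
lemma pathPoint_lt_opposite {f : ℂ →ₗ[ℝ] ℝ}
    (hf : ∀ i < k, 0 < f ((g (i + 1) - g i) + (g (2 * k - i) - g (2 * k - i - 1)))) {t : ℝ}
    (ht0 : 0 ≤ t) (htk : t < k) :
    f (pathPoint (2 * k) g t) < f (pathPoint (2 * k) g (2 * k - t)) := by
  have hk : ∀ i ∈ Finset.range k, ((i + 1 : ℕ) : ℝ) ≤ k := fun i hi => by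
    exact_mod_cast Finset.mem_range.1 hi
  -- Edge `i` and its opposite, edge `2 * k - 1 - i`, enter the difference with the same weight: the
  -- part of edge `i` not yet covered at time `t`.
  have key : pathPoint (2 * k) g (2 * k - t) - pathPoint (2 * k) g t
      = ∑ i ∈ Finset.range k, (1 - clamp (t - i)) •
        ((g (i + 1) - g i) + (g (2 * k - i) - g (2 * k - i - 1))) := by
    simp only [pathPoint]
    rw [add_sub_add_left_eq_sub, ← Finset.sum_sub_distrib, two_mul k, Finset.sum_range_add,
      ← Finset.sum_range_reflect (fun x => clamp (_ - ((k + x : ℕ) : ℝ)) • _ - _) k,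
      ← Finset.sum_add_distrib]
    refine Finset.sum_congr rfl fun i hi => ?_
    have hi1 := hk i hi
    have hi2 := Finset.mem_range.1 hi
    push_cast at hi1
    have e1 : k + (k - 1 - i) + 1 = k + k - i := by omega
    have e2 : k + (k - 1 - i) = k + k - i - 1 := by omega
    have e3 : ((k + (k - 1 - i) : ℕ) : ℝ) = 2 * k - i - 1 := by
      have : k + (k - 1 - i) + (i + 1) = k + k := by omega
      have h := congrArg (Nat.cast : ℕ → ℝ) this
      push_cast at h ⊢
      linarith
    rw [e1, e3, e2]
    have c1 : clamp (2 * k - t - i) = 1 := clamp_of_one_le (by linarith)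
    have c2 : clamp (2 * k - t - (2 * k - i - 1)) = 1 - clamp (t - i) := by
      rw [← clamp_one_sub]; congr 1; ring
    have c3 : clamp (t - (2 * k - i - 1)) = 0 := clamp_of_nonpos (by linarith)
    rw [c1, c2, c3]
    module
  rw [← sub_pos, ← map_sub, key, map_sum]
  simp only [map_smul, smul_eq_mul]
  have hkpos : 0 < k := by
    have : (0 : ℝ) < k := lt_of_le_of_lt ht0 htk
    exact_mod_cast this
  refine Finset.sum_pos' (fun i hi => ?_) ⟨k - 1, Finset.mem_range.2 (by omega), ?_⟩
  · exact mul_nonneg (by linarith [clamp_le_one (t - i)]) (hf i (Finset.mem_range.1 hi)).le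
  · refine mul_pos ?_ (hf _ (by omega))
    have e : ((k - 1 : ℕ) : ℝ) = k - 1 := by
      rw [Nat.cast_sub (by omega), Nat.cast_one]
    rw [e]
    have : clamp (t - (k - 1)) < 1 := by
      rw [clamp]
      exact max_lt one_pos (lt_of_le_of_lt (min_le_right _ _) (by linarith))
    linarith

/-- A path with `2 * k` edges whose first `k` edges point upwards, whose last `k` edges point
downwards, and whose opposite edges have sums that point to the right; the directions are
measured by two linear functions. -/
structure IsHairpin (k : ℕ) (g : ℕ → ℂ) (f₁ f₂ : ℂ →ₗ[ℝ] ℝ) : Prop where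
  pos : 0 < k
  up₁ : ∀ i < k, 0 < f₁ (g (i + 1) - g i)
  up₂ : ∀ i < k, 0 < f₂ (g (i + 1) - g i)
  down₁ : ∀ i, k ≤ i → i < 2 * k → f₁ (g (i + 1) - g i) < 0
  down₂ : ∀ i, k ≤ i → i < 2 * k → f₂ (g (i + 1) - g i) < 0
  right₁ : ∀ i < k, f₁ ((g (i + 1) - g i) + (g (2 * k - i) - g (2 * k - i - 1))) < 0
  right₂ : ∀ i < k, 0 < f₂ ((g (i + 1) - g i) + (g (2 * k - i) - g (2 * k - i - 1)))

namespace IsHairpin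

variable {f₁ f₂ : ℂ →ₗ[ℝ] ℝ}

lemma lt_up₁ (h : IsHairpin k g f₁ f₂) {s t : ℝ} (hs : 0 ≤ s) (hst : s < t) (ht : t ≤ k) :
    f₁ (pathPoint (2 * k) g s) < f₁ (pathPoint (2 * k) g t) :=
  pathPoint_strictMono (a := 0) (by omega) (fun i _ hi => h.up₁ i hi) (by simpa using hs) hst ht

lemma lt_up₂ (h : IsHairpin k g f₁ f₂) {s t : ℝ} (hs : 0 ≤ s) (hst : s < t) (ht : t ≤ k) :
    f₂ (pathPoint (2 * k) g s) < f₂ (pathPoint (2 * k) g t) :=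
  pathPoint_strictMono (a := 0) (by omega) (fun i _ hi => h.up₂ i hi) (by simpa using hs) hst ht

lemma lt_down₁ (h : IsHairpin k g f₁ f₂) {s t : ℝ} (hs : k ≤ s) (hst : s < t)
    (ht : t ≤ 2 * k) : f₁ (pathPoint (2 * k) g t) < f₁ (pathPoint (2 * k) g s) := by
  have := pathPoint_strictMono (g := g) (f := -f₁) (a := k) le_rfl
    (fun i h1 h2 => by simpa using h.down₁ i h1 h2) hs hst (by push_cast; exact ht)
  simpa using this

lemma lt_down₂ (h : IsHairpin k g f₁ f₂) {s t : ℝ} (hs : k ≤ s) (hst : s < t)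
    (ht : t ≤ 2 * k) : f₂ (pathPoint (2 * k) g t) < f₂ (pathPoint (2 * k) g s) := by
  have := pathPoint_strictMono (g := g) (f := -f₂) (a := k) le_rfl
    (fun i h1 h2 => by simpa using h.down₂ i h1 h2) hs hst (by push_cast; exact ht)
  simpa using this

lemma lt_right₁ (h : IsHairpin k g f₁ f₂) {t : ℝ} (ht0 : 0 ≤ t) (htk : t < k) :
    f₁ (pathPoint (2 * k) g (2 * k - t)) < f₁ (pathPoint (2 * k) g t) := by
  have := pathPoint_lt_opposite (g := g) (f := -f₁) (k := k)
    (fun i hi => by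
      have := h.right₁ i hi
      rw [LinearMap.neg_apply]; linarith) ht0 htk
  simpa using this

lemma lt_right₂ (h : IsHairpin k g f₁ f₂) {t : ℝ} (ht0 : 0 ≤ t) (htk : t < k) :
    f₂ (pathPoint (2 * k) g t) < f₂ (pathPoint (2 * k) g (2 * k - t)) :=
  pathPoint_lt_opposite h.right₂ ht0 htk

/-- Within one half of the path `f₁` is strictly monotone. Otherwise the point at `t` is compared
with the point opposite to `s`, which is further right: if it comes earlier on the descent, `f₂`
separates it from the point at `s`; if it comes later, `f₁` does. -/
lemma ne_of_lt (h : IsHairpin k g f₁ f₂) {s t : ℝ} (hs : 0 ≤ s) (hst : s < t)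
    (ht : t ≤ 2 * k) : pathPoint (2 * k) g s ≠ pathPoint (2 * k) g t := by
  intro heq
  rcases le_or_gt t k with h1 | h1
  · exact (h.lt_up₁ hs hst h1).ne (congrArg f₁ heq)
  · rcases le_or_gt (k : ℝ) s with h2 | h2
    · exact (h.lt_down₁ h2 hst ht).ne (congrArg f₁ heq.symm)
    · have h3 := h.lt_right₁ hs h2
      have h4 := h.lt_right₂ hs h2
      rw [heq] at h3 h4
      rcases lt_trichotomy t (2 * k - s) with h5 | h5 | h5
      · exact absurd h4 (not_lt.2 (h.lt_down₂ h1.le h5 (by linarith)).le)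
      · rw [← h5] at h3
        exact lt_irrefl _ h3
      · exact absurd h3 (not_lt.2 (h.lt_down₁ (by linarith) h5 ht).le)

lemma isSimplePath (h : IsHairpin k g f₁ f₂) : IsSimplePath (2 * k) g := by
  refine isSimplePath_of_injOn fun s hs t ht heq => ?_
  rcases lt_trichotomy s t with h1 | h1 | h1
  · exact absurd heq (h.ne_of_lt hs.1 h1 (by simpa using ht.2))
  · exact h1
  · exact absurd heq.symm (h.ne_of_lt ht.1 h1 (by simpa using hs.2))

lemma start_eq : pathPoint (2 * k) g 0 = g 0 := by
  have := pathPoint_natCast (g := g) (Nat.zero_le (2 * k))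
  simpa using this

lemma end_eq : pathPoint (2 * k) g (2 * k) = g (2 * k) := by
  have := pathPoint_natCast (g := g) (le_refl (2 * k))
  simpa using this

lemma base₁ (h : IsHairpin k g f₁ f₂) : f₁ (g (2 * k)) < f₁ (g 0) := by
  have := h.lt_right₁ le_rfl (by exact_mod_cast h.pos)
  rwa [sub_zero, start_eq, end_eq] at this

lemma base₂ (h : IsHairpin k g f₁ f₂) : f₂ (g 0) < f₂ (g (2 * k)) := by
  have := h.lt_right₂ le_rfl (by exact_mod_cast h.pos)
  rwa [sub_zero, start_eq, end_eq] at this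

lemma start_ne_end (h : IsHairpin k g f₁ f₂) : g 0 ≠ g (2 * k) := fun heq =>
  h.base₁.ne' (congrArg f₁ heq)

/-- Every point of the path is an end point or lies above one of the end points. -/
lemma cases_of_mem_trace (h : IsHairpin k g f₁ f₂) {x : ℂ} (hx : x ∈ trace (2 * k) g) :
    x = g 0 ∨ x = g (2 * k) ∨ (f₁ (g 0) < f₁ x ∧ f₂ (g 0) < f₂ x) ∨
      (f₁ (g (2 * k)) < f₁ x ∧ f₂ (g (2 * k)) < f₂ x) := by
  obtain ⟨t, h0, h1, rfl⟩ := exists_pathPoint_of_mem_trace hx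
  push_cast at h1
  have hk : (0 : ℝ) < k := by exact_mod_cast h.pos
  rcases le_total t k with h2 | h2
  · rcases eq_or_lt_of_le h0 with rfl | h3
    · exact Or.inl start_eq
    · refine Or.inr (Or.inr (Or.inl ?_))
      rw [← start_eq (k := k) (g := g)]
      exact ⟨h.lt_up₁ le_rfl h3 h2, h.lt_up₂ le_rfl h3 h2⟩
  · rcases eq_or_lt_of_le h1 with rfl | h3
    · exact Or.inr (Or.inl end_eq)
    · refine Or.inr (Or.inr (Or.inr ?_))
      rw [← end_eq (k := k) (g := g)]
      exact ⟨h.lt_down₁ h2 h3 le_rfl, h.lt_down₂ h2 h3 le_rfl⟩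

lemma start_mem_trace (hk : 0 < k) : g 0 ∈ trace (2 * k) g := by
  simp only [trace, Set.mem_iUnion]
  exact ⟨0, by omega, left_mem_segment _ _ _⟩

lemma end_mem_trace (hk : 0 < k) : g (2 * k) ∈ trace (2 * k) g := by
  simp only [trace, Set.mem_iUnion]
  refine ⟨2 * k - 1, by omega, ?_⟩
  have : 2 * k - 1 + 1 = 2 * k := by omega
  rw [this]
  exact right_mem_segment _ _ _

/-- Along the base line `f₁` and `f₂` vary in opposite senses, so none of its points exceeds an end
point in both. -/
lemma line_inter_trace (h : IsHairpin k g f₁ f₂) :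
    (line[ℝ, g 0, g (2 * k)] : Set ℂ) ∩ trace (2 * k) g = {g 0, g (2 * k)} := by
  refine Set.Subset.antisymm ?_ ?_
  · rintro x ⟨hx1, hx2⟩
    obtain ⟨r, rfl⟩ := mem_affineSpan_pair_iff_exists_lineMap_eq.1 hx1
    have e : ∀ f : ℂ →ₗ[ℝ] ℝ, f (AffineMap.lineMap (g 0) (g (2 * k)) r)
        = f (g 0) + r * (f (g (2 * k)) - f (g 0)) := by
      intro f
      rw [AffineMap.lineMap_apply]
      simp only [vsub_eq_sub, vadd_eq_add, map_add, map_smul, map_sub, smul_eq_mul]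
      ring
    have b1 := h.base₁
    have b2 := h.base₂
    rcases h.cases_of_mem_trace hx2 with h1 | h1 | ⟨h1, h2⟩ | ⟨h1, h2⟩
    · exact Or.inl h1
    · exact Or.inr h1
    · rw [e] at h1 h2
      rcases le_total r 0 with hr | hr <;> nlinarith
    · rw [e] at h1 h2
      rcases le_total r 1 with hr | hr <;> nlinarith
  · rintro x (rfl | rfl)
    · exact ⟨left_mem_affineSpan_pair ℝ _ _, start_mem_trace h.pos⟩
    · exact ⟨right_mem_affineSpan_pair ℝ _ _, end_mem_trace h.pos⟩

/-- Gives a supporting line of the closed path at each end of the base, as needed to identify the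
interior angles. -/
lemma closedTrace_bounds (h : IsHairpin k g f₁ f₂) {x : ℂ} (hx : x ∈ closedTrace (2 * k) g) :
    f₁ (g (2 * k)) ≤ f₁ x ∧ f₂ (g 0) ≤ f₂ x := by
  have b1 := h.base₁
  have b2 := h.base₂
  rcases hx with hx | hx
  · rcases h.cases_of_mem_trace hx with rfl | rfl | ⟨h1, h2⟩ | ⟨h1, h2⟩
    · exact ⟨b1.le, le_rfl⟩
    · exact ⟨le_rfl, b2.le⟩
    · exact ⟨by linarith, h2.le⟩
    · exact ⟨h1.le, by linarith⟩
  · rw [segment_eq_image'] at hx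
    obtain ⟨r, ⟨h0, h1⟩, rfl⟩ := hx
    simp only [map_add, map_smul, map_sub, smul_eq_mul]
    constructor <;> nlinarith

end IsHairpin
end

/-! ### Interior angles -/

lemma argIoc_lt_pi {z : ℂ} (hz : 0 < z.im) : argIoc z < Real.pi := by
  by_contra hc
  push Not at hc
  have hm := argIoc_mem z
  have h := congrArg Complex.im (exp_argIoc z)
  rw [Complex.im_ofReal_mul, Complex.exp_ofReal_mul_I_im] at h
  have h2 : 0 ≤ Real.sin (argIoc z - Real.pi) :=
    Real.sin_nonneg_of_nonneg_of_le_pi (by linarith) (by linarith [hm.2])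
  rw [Real.sin_sub_pi] at h2
  have := mul_nonneg (norm_nonneg z) h2
  linarith

lemma pi_lt_argIoc {z : ℂ} (hz : z.im < 0) : Real.pi < argIoc z := by
  by_contra hc
  push Not at hc
  have h := congrArg Complex.im (exp_argIoc z)
  rw [Complex.im_ofReal_mul, Complex.exp_ofReal_mul_I_im] at h
  have h2 := Real.sin_nonneg_of_nonneg_of_le_pi (argIoc_mem z).1.le hc
  have := mul_nonneg (norm_nonneg z) h2
  linarith

/-- A half-plane that misses the curve is connected and unbounded. -/
lemma notMem_inside {C : Set ℂ} {f : ℂ →ₗ[ℝ] ℝ} {c : ℝ} (hC : ∀ x ∈ C, c ≤ f x) {x d : ℂ}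
    (hx : f x < c) (hd : f d < 0) : x ∉ inside C := by
  rintro ⟨_, hb⟩
  have hconv : Convex ℝ {y : ℂ | f y < c} := convex_halfSpace_lt f.isLinear c
  have hsub : {y : ℂ | f y < c} ⊆ connectedComponentIn Cᶜ x :=
    hconv.isPreconnected.subset_connectedComponentIn hx
      fun y hy hyC => absurd (hC y hyC) (not_le.2 hy)
  obtain ⟨R, hR⟩ := isBounded_iff_forall_norm_le.1 (hb.subset hsub)
  have hd0 : d ≠ 0 := by rintro rfl; simp at hd
  have hnd : 0 < ‖d‖ := norm_pos_iff.2 hd0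
  have hR0 : 0 ≤ R := (norm_nonneg x).trans (hR x hx)
  set r : ℝ := (R + ‖x‖ + 1) / ‖d‖ with hr
  have hr0 : 0 < r := by positivity
  have h1 := hR (x + r • d) (by
    change f (x + r • d) < c
    rw [map_add, map_smul, smul_eq_mul]
    nlinarith)
  have h2 : ‖r • d‖ = R + ‖x‖ + 1 := by
    rw [norm_smul, Real.norm_of_nonneg hr0.le, hr, div_mul_cancel₀ _ hnd.ne']
  have h3 : ‖r • d‖ ≤ ‖x + r • d‖ + ‖x‖ := by
    have := norm_sub_le (x + r • d) x
    rwa [add_sub_cancel_left] at this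
  linarith

/-- If the closed path lies on one side of a line through its vertex `v`, and if the left angle at
`v` is greater than `π`, then the interior angle is the right angle. -/
lemma interiorAngle_eq {C : Set ℂ} {f : ℂ →ₗ[ℝ] ℝ} {p v q d : ℂ} (hC : ∀ x ∈ C, f v ≤ f x)
    (hd : f d < 0) (hpd : 0 < ((p - v) / d).im) (hpq : ((p - v) / (q - v)).im < 0) :
    interiorAngle C p v q = planeAngle q v p := by
  rw [interiorAngle, if_neg]
  intro hev
  have hd0 : d ≠ 0 := by rintro rfl; simp at hd
  have hlim : Filter.Tendsto (fun r : ℝ => v + r • d) (nhdsWithin 0 (Set.Ioi 0))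
      (nhdsWithin v {v}ᶜ) := by
    refine tendsto_nhdsWithin_iff.2 ⟨?_, ?_⟩
    · have : Continuous fun r : ℝ => v + r • d := by fun_prop
      have h := this.tendsto 0
      simp only [zero_smul, add_zero] at h
      exact h.mono_left nhdsWithin_le_nhds
    · filter_upwards [self_mem_nhdsWithin] with r hr
      have : r ≠ 0 := (show 0 < r from hr).ne'
      simp [this, hd0]
  -- Points slightly off `v` in direction `d` are to the left of the path, yet not enclosed.
  obtain ⟨r, hr, hr0⟩ := ((hlim.eventually hev).and self_mem_nhdsWithin).exists
  have hr0 : 0 < r := hr0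
  refine notMem_inside hC (x := v + r • d) ?_ hd (hr ?_)
  · rw [map_add, map_smul, smul_eq_mul]
    nlinarith
  · refine (argIoc_lt_pi ?_).trans (pi_lt_argIoc hpq)
    rw [add_sub_cancel_left, Complex.real_smul, div_mul_eq_div_div_swap, Complex.div_ofReal_im]
    exact div_pos hpd hr0

/-! ### Nearly straight hairpins -/

/-- The complex number with modulus `c` and argument `t` with respect to the unit vector `U`. -/
noncomputable def polar (U : ℂ) (c t : ℝ) : ℂ := c * Complex.exp (t * Complex.I) * U

section

variable {U : ℂ}

lemma polar_mul_conj (hU : ‖U‖ = 1) (c t : ℝ) :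
    polar U c t * (starRingEnd ℂ) U = c * Complex.exp (t * Complex.I) := by
  rw [polar, mul_assoc, Complex.mul_conj, Complex.normSq_eq_norm_sq, hU]; simp

lemma polar_add_pi (c t : ℝ) : polar U c (t + Real.pi) = -polar U c t := by
  simp only [polar]
  push_cast
  rw [add_mul, Complex.exp_add, Complex.exp_pi_mul_I]; ring

lemma polar_div_polar (hU : ‖U‖ = 1) (c c' t t' : ℝ) :
    polar U c t / polar U c' t' = (c / c' : ℝ) * Complex.exp ((t - t' : ℝ) * Complex.I) := by
  have hU0 : U ≠ 0 := by rintro rfl; simp at hU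
  rw [polar, polar, mul_div_mul_right _ _ hU0, mul_div_mul_comm, ← Complex.exp_sub]
  push_cast
  rw [sub_mul]

lemma im_polar_div_polar (hU : ‖U‖ = 1) (c c' t t' : ℝ) :
    (polar U c t / polar U c' t').im = c / c' * Real.sin (t - t') := by
  rw [polar_div_polar hU, Complex.im_ofReal_mul, Complex.exp_ofReal_mul_I_im]

lemma argIoc_polar_div_polar (hU : ‖U‖ = 1) {c c' t t' : ℝ} (hc : 0 < c) (hc' : 0 < c')
    (h0 : 0 < t - t') (h1 : t - t' ≤ 2 * Real.pi) :
    argIoc (polar U c t / polar U c' t') = t - t' := by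
  rw [polar_div_polar hU, argIoc_eq (div_pos hc hc') h0 h1]

/-- Two equally long, nearly opposite edges add up to the base of a thin isosceles triangle,
perpendicular to its bisector. -/
lemma polar_sub_polar (c φ δ : ℝ) :
    polar U c φ - polar U c (φ + δ)
      = polar U (2 * c * Real.sin (δ / 2)) (φ + δ / 2 - Real.pi / 2) := by
  have key : Complex.exp (φ * Complex.I) - Complex.exp ((φ + δ : ℝ) * Complex.I)
      = (2 * Real.sin (δ / 2) : ℝ) *
        Complex.exp ((φ + δ / 2 - Real.pi / 2 : ℝ) * Complex.I) := by
    have e1 : Real.cos φ = Real.cos (φ + δ / 2 - δ / 2) := by ring_nf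
    have e2 : Real.sin φ = Real.sin (φ + δ / 2 - δ / 2) := by ring_nf
    have e3 : φ + δ = φ + δ / 2 + δ / 2 := by ring
    apply Complex.ext
    · rw [Complex.sub_re, Complex.re_ofReal_mul, Complex.exp_ofReal_mul_I_re,
        Complex.exp_ofReal_mul_I_re, Complex.exp_ofReal_mul_I_re, Real.cos_sub_pi_div_two, e1, e3,
        Real.cos_add (φ + δ / 2), Real.cos_sub (φ + δ / 2)]
      ring
    · rw [Complex.sub_im, Complex.im_ofReal_mul, Complex.exp_ofReal_mul_I_im,
        Complex.exp_ofReal_mul_I_im, Complex.exp_ofReal_mul_I_im, Real.sin_sub_pi_div_two, e2, e3,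
        Real.sin_add (φ + δ / 2), Real.sin_sub (φ + δ / 2)]
      ring
  simp only [polar]
  rw [← sub_mul, ← mul_sub, key]
  push_cast
  ring

/-- The linear functions `re ± im` in the coordinates with real axis spanned by `U`. -/
noncomputable def slantPlus (U : ℂ) : ℂ →ₗ[ℝ] ℝ :=
  (Complex.reLm + Complex.imLm) ∘ₗ LinearMap.mulRight ℝ ((starRingEnd ℂ) U)

/-- See `slantPlus`. -/
noncomputable def slantMinus (U : ℂ) : ℂ →ₗ[ℝ] ℝ :=
  (Complex.reLm - Complex.imLm) ∘ₗ LinearMap.mulRight ℝ ((starRingEnd ℂ) U)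

lemma slantPlus_polar (hU : ‖U‖ = 1) (c t : ℝ) :
    slantPlus U (polar U c t) = c * (Real.cos t + Real.sin t) := by
  have : slantPlus U (polar U c t) = (polar U c t * (starRingEnd ℂ) U).re
    + (polar U c t * (starRingEnd ℂ) U).im := rfl
  rw [this, polar_mul_conj hU, Complex.re_ofReal_mul, Complex.im_ofReal_mul,
    Complex.exp_ofReal_mul_I_re, Complex.exp_ofReal_mul_I_im]
  ring

lemma slantMinus_polar (hU : ‖U‖ = 1) (c t : ℝ) :
    slantMinus U (polar U c t) = c * (Real.cos t - Real.sin t) := by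
  have : slantMinus U (polar U c t) = (polar U c t * (starRingEnd ℂ) U).re
    - (polar U c t * (starRingEnd ℂ) U).im := rfl
  rw [this, polar_mul_conj hU, Complex.re_ofReal_mul, Complex.im_ofReal_mul,
    Complex.exp_ofReal_mul_I_re, Complex.exp_ofReal_mul_I_im]
  ring

lemma abs_sin_lt_cos {t : ℝ} (ht : |t| ≤ 1 / 2) : |Real.sin t| < Real.cos t := by
  have h1 : |Real.sin t| ≤ |t| := Real.abs_sin_le_abs
  have h2 := Real.one_sub_sq_div_two_le_cos (x := t)
  have h3 : t ^ 2 ≤ (1 / 2) ^ 2 := by rw [← sq_abs]; gcongr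
  linarith

/-- A positive combination of vectors with small arguments has a small argument. -/
lemma exists_polar_sum {k : ℕ} (hk : 0 < k) {c t : ℕ → ℝ} {η : ℝ} (hη : η ≤ 1 / 2)
    (hc : ∀ i < k, 0 < c i) (ht : ∀ i < k, |t i| ≤ η) :
    ∃ r a : ℝ, 0 < r ∧ |a| ≤ η ∧
      ∑ i ∈ Finset.range k, polar U (c i) (t i - Real.pi / 2) = polar U r (a - Real.pi / 2) := by
  set z : ℂ := ∑ i ∈ Finset.range k, (c i : ℂ) * Complex.exp (t i * Complex.I) with hz
  have hη0 : 0 ≤ η := (abs_nonneg _).trans (ht 0 hk)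
  have hpi := Real.pi_gt_three
  have hcos : ∀ i < k, 0 < Real.cos (t i) := fun i hi =>
    lt_of_le_of_lt (abs_nonneg _) (abs_sin_lt_cos ((ht i hi).trans hη))
  -- The sector of half-angle `η` is described by linear inequalities, which are preserved by sums.
  have htan : ∀ i < k, |Real.sin (t i)| ≤ Real.tan η * Real.cos (t i) := by
    intro i hi
    have h1 := abs_le.1 (ht i hi)
    have hcη : 0 < Real.cos η := Real.cos_pos_of_mem_Ioo ⟨by linarith, by linarith⟩
    have h2 : 0 ≤ Real.sin (η - t i) :=
      Real.sin_nonneg_of_nonneg_of_le_pi (by linarith) (by linarith)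
    have h3 : 0 ≤ Real.sin (η + t i) :=
      Real.sin_nonneg_of_nonneg_of_le_pi (by linarith) (by linarith)
    rw [Real.sin_sub] at h2
    rw [Real.sin_add] at h3
    rw [Real.tan_eq_sin_div_cos, div_mul_eq_mul_div, le_div_iff₀ hcη, ← abs_of_pos hcη, ← abs_mul,
      abs_le]
    constructor <;> linarith
  have hre : z.re = ∑ i ∈ Finset.range k, c i * Real.cos (t i) := by
    rw [hz, Complex.re_sum]
    exact Finset.sum_congr rfl fun i _ => by
      rw [Complex.re_ofReal_mul, Complex.exp_ofReal_mul_I_re]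
  have him : z.im = ∑ i ∈ Finset.range k, c i * Real.sin (t i) := by
    rw [hz, Complex.im_sum]
    exact Finset.sum_congr rfl fun i _ => by
      rw [Complex.im_ofReal_mul, Complex.exp_ofReal_mul_I_im]
  have hre0 : 0 < z.re := by
    rw [hre]
    exact Finset.sum_pos (fun i hi => mul_pos (hc i (Finset.mem_range.1 hi))
      (hcos i (Finset.mem_range.1 hi))) ⟨0, Finset.mem_range.2 hk⟩
  have hle : |z.im| ≤ Real.tan η * z.re := by
    rw [him, hre, Finset.mul_sum]
    refine (Finset.abs_sum_le_sum_abs _ _).trans (Finset.sum_le_sum fun i hi => ?_)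
    have hi := Finset.mem_range.1 hi
    rw [abs_mul, abs_of_pos (hc i hi)]
    have := mul_le_mul_of_nonneg_left (htan i hi) (hc i hi).le
    linarith
  have harg2 : |z.arg| < Real.pi / 2 := Complex.abs_arg_lt_pi_div_two_iff.2 (Or.inl hre0)
  have harg : z.arg = Real.arctan (z.im / z.re) := by
    rw [← Complex.tan_arg, Real.arctan_tan (abs_lt.1 harg2).1 (abs_lt.1 harg2).2]
  have hηa : η = Real.arctan (Real.tan η) :=
    (Real.arctan_tan (by linarith) (by linarith)).symm
  have hdiv : |z.im / z.re| ≤ Real.tan η := by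
    rw [abs_div, abs_of_pos hre0, div_le_iff₀ hre0]; exact hle
  refine ⟨‖z‖, z.arg, norm_pos_iff.2 (by rintro h; rw [h] at hre0; simp at hre0), ?_, ?_⟩
  · rw [harg, hηa, abs_le, ← Real.arctan_neg]
    exact ⟨Real.arctan_mono (abs_le.1 hdiv).1, Real.arctan_mono (abs_le.1 hdiv).2⟩
  · have e : ∀ c t : ℝ, polar U c (t - Real.pi / 2)
        = c * Complex.exp (t * Complex.I) * (-Complex.I * U) := by
      intro c t
      have : ((t - Real.pi / 2 : ℝ) : ℂ) * Complex.I
          = t * Complex.I + -(Real.pi / 2 * Complex.I) := by push_cast; ring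
      rw [polar, this, Complex.exp_add, Complex.exp_neg, Complex.exp_pi_div_two_mul_I,
        Complex.inv_I]
      ring
    simp only [e]
    rw [← Finset.sum_mul, ← hz, Complex.norm_mul_exp_arg_mul_I]

variable {k : ℕ} {g : ℕ → ℂ} {L φ δ : ℕ → ℝ} {η : ℝ}

/-- With `η ≤ 1 / 4` all arguments stay within `1 / 2` of the directions up, down and right, where
both slanted functions have a definite sign. -/
lemma isHairpin_of_polar (hU : ‖U‖ = 1) (hk : 0 < k) (hη : η ≤ 1 / 4) (hL : ∀ i < k, 0 < L i)
    (hφ : ∀ i < k, |φ i| ≤ η) (hδ : ∀ i < k, 0 < δ i ∧ δ i ≤ η)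
    (he : ∀ i < k, g (i + 1) - g i = polar U (L i) (φ i))
    (hr : ∀ i < k, g (2 * k - i) - g (2 * k - i - 1) = -polar U (L i) (φ i + δ i)) :
    IsHairpin k g (slantPlus U) (slantMinus U) := by
  have hpi := Real.pi_gt_three
  have h1 : ∀ i < k, |Real.sin (φ i)| < Real.cos (φ i) := fun i hi =>
    abs_sin_lt_cos (by linarith [hφ i hi])
  have h2 : ∀ i < k, |Real.sin (φ i + δ i)| < Real.cos (φ i + δ i) := fun i hi => by
    refine abs_sin_lt_cos ((abs_add_le _ _).trans ?_)
    rw [abs_of_pos (hδ i hi).1]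
    linarith [hφ i hi, (hδ i hi).2]
  have h3 : ∀ i < k, |Real.sin (φ i + δ i / 2)| < Real.cos (φ i + δ i / 2) := fun i hi => by
    refine abs_sin_lt_cos ((abs_add_le _ _).trans ?_)
    rw [abs_of_pos (by linarith [(hδ i hi).1] : 0 < δ i / 2)]
    linarith [hφ i hi, hδ i hi]
  have h4 : ∀ i < k, 0 < 2 * L i * Real.sin (δ i / 2) := fun i hi =>
    mul_pos (by linarith [hL i hi]) (Real.sin_pos_of_pos_of_lt_pi (by linarith [(hδ i hi).1])
      (by linarith [(hδ i hi).2]))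
  have hdown : ∀ i, k ≤ i → i < 2 * k → ∃ j < k, g (i + 1) - g i = -polar U (L j) (φ j + δ j) := by
    intro i hi hi'
    refine ⟨2 * k - 1 - i, by omega, ?_⟩
    rw [← hr _ (by omega)]
    congr 2 <;> omega
  have hsum : ∀ i < k, (g (i + 1) - g i) + (g (2 * k - i) - g (2 * k - i - 1))
      = polar U (2 * L i * Real.sin (δ i / 2)) (φ i + δ i / 2 - Real.pi / 2) := fun i hi => by
    rw [he i hi, hr i hi, ← polar_sub_polar, sub_eq_add_neg]
  refine ⟨hk, ?_, ?_, ?_, ?_, ?_, ?_⟩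
  · intro i hi
    rw [he i hi, slantPlus_polar hU]
    exact mul_pos (hL i hi) (by linarith [abs_lt.1 (h1 i hi)])
  · intro i hi
    rw [he i hi, slantMinus_polar hU]
    exact mul_pos (hL i hi) (by linarith [abs_lt.1 (h1 i hi)])
  · intro i hi hi'
    obtain ⟨j, hj, e⟩ := hdown i hi hi'
    rw [e, map_neg, slantPlus_polar hU, neg_lt_zero]
    exact mul_pos (hL j hj) (by linarith [abs_lt.1 (h2 j hj)])
  · intro i hi hi'
    obtain ⟨j, hj, e⟩ := hdown i hi hi'
    rw [e, map_neg, slantMinus_polar hU, neg_lt_zero]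
    exact mul_pos (hL j hj) (by linarith [abs_lt.1 (h2 j hj)])
  · intro i hi
    rw [hsum i hi, slantPlus_polar hU, Real.cos_sub_pi_div_two, Real.sin_sub_pi_div_two]
    exact mul_neg_of_pos_of_neg (h4 i hi) (by linarith [abs_lt.1 (h3 i hi)])
  · intro i hi
    rw [hsum i hi, slantMinus_polar hU, Real.cos_sub_pi_div_two, Real.sin_sub_pi_div_two]
    exact mul_pos (h4 i hi) (by linarith [abs_lt.1 (h3 i hi)])

/-- The base edge is the sum of the sums of opposite edges, so its argument is `a - π / 2` with `|a|
≤ 2 * η`. The base angles are `φ 0 - a + π / 2` and `a + π / 2 - (φ 0 + δ 0)`. -/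
lemma angles_of_polar (hU : ‖U‖ = 1) (hk : 0 < k) (hη : η ≤ 1 / 4) (hL : ∀ i < k, 0 < L i)
    (hφ : ∀ i < k, |φ i| ≤ η) (hδ : ∀ i < k, 0 < δ i ∧ δ i ≤ η)
    (he : ∀ i < k, g (i + 1) - g i = polar U (L i) (φ i))
    (hr : ∀ i < k, g (2 * k - i) - g (2 * k - i - 1) = -polar U (L i) (φ i + δ i)) :
    startAngle (2 * k) g + endAngle (2 * k) g = Real.pi - δ 0 ∧
    |startAngle (2 * k) g - Real.pi / 2| ≤ 3 * η ∧
    |endAngle (2 * k) g - Real.pi / 2| ≤ 4 * η := by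
  have hpi := Real.pi_gt_three
  have hH := isHairpin_of_polar hU hk hη hL hφ hδ he hr
  have hsum : ∑ i ∈ Finset.range k,
      polar U (2 * L i * Real.sin (δ i / 2)) (φ i + δ i / 2 - Real.pi / 2) = g (2 * k) - g 0 := by
    have h1 : ∑ i ∈ Finset.range k, (g (i + 1) - g i) = g k - g 0 := Finset.sum_range_sub g k
    have h2 : ∑ i ∈ Finset.range k, (g (2 * k - i) - g (2 * k - i - 1)) = g (2 * k) - g k := by
      have := Finset.sum_range_sub' (fun i => g (2 * k - i)) k
      have e : 2 * k - k = k := by omega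
      rw [e] at this
      exact this
    have h3 : g (2 * k) - g 0 = (g k - g 0) + (g (2 * k) - g k) := by ring
    rw [h3, ← h1, ← h2, ← Finset.sum_add_distrib]
    refine Finset.sum_congr rfl fun i hi => ?_
    have hi := Finset.mem_range.1 hi
    rw [he i hi, hr i hi, ← polar_sub_polar, sub_eq_add_neg]
  obtain ⟨r, a, hr0, ha, hs⟩ := exists_polar_sum (U := U) hk (η := 2 * η)
    (c := fun i => 2 * L i * Real.sin (δ i / 2)) (t := fun i => φ i + δ i / 2) (by linarith)
    (fun i hi => mul_pos (by linarith [hL i hi])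
      (Real.sin_pos_of_pos_of_lt_pi (by linarith [(hδ i hi).1]) (by linarith [(hδ i hi).2])))
    (fun i hi => by
      refine (abs_add_le _ _).trans ?_
      rw [abs_of_pos (by linarith [(hδ i hi).1] : 0 < δ i / 2)]
      linarith [hφ i hi, hδ i hi])
  rw [hsum] at hs
  have he0 := he 0 hk
  have hr0' := hr 0 hk
  rw [Nat.sub_zero] at hr0'
  have hf0 : g (2 * k - 1) - g (2 * k) = polar U (L 0) (φ 0 + δ 0) := by
    rw [← neg_sub, hr0', neg_neg]
  have hs' : g 0 - g (2 * k) = polar U r (a + Real.pi / 2) := by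
    rw [← neg_sub, hs, ← polar_add_pi]; congr 1; ring
  have hL0 := hL 0 hk
  have hφ0 := abs_le.1 (hφ 0 hk)
  have hδ0 := hδ 0 hk
  have ha' := abs_le.1 ha
  have hstart : startAngle (2 * k) g = φ 0 - a + Real.pi / 2 := by
    rw [startAngle, interiorAngle_eq (f := slantMinus U) (d := polar U 1 (-Real.pi))
      (fun x hx => (hH.closedTrace_bounds hx).2)]
    · rw [planeAngle, he0, hs, argIoc_polar_div_polar hU hL0 hr0 (by linarith) (by linarith)]
      ring
    · rw [slantMinus_polar hU]; simp
    · rw [hs, im_polar_div_polar hU]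
      exact mul_pos (by positivity) (Real.sin_pos_of_pos_of_lt_pi (by linarith) (by linarith))
    · rw [hs, he0, im_polar_div_polar hU]
      exact mul_neg_of_pos_of_neg (by positivity)
        (Real.sin_neg_of_neg_of_neg_pi_lt (by linarith) (by linarith))
  have hend : endAngle (2 * k) g = a + Real.pi / 2 - (φ 0 + δ 0) := by
    rw [endAngle, interiorAngle_eq (f := slantPlus U) (d := polar U 1 (-(Real.pi / 2)))
      (fun x hx => (hH.closedTrace_bounds hx).1)]
    · rw [planeAngle, hs', hf0, argIoc_polar_div_polar hU hr0 hL0 (by linarith) (by linarith)]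
    · rw [slantPlus_polar hU]; simp
    · rw [hf0, im_polar_div_polar hU]
      exact mul_pos (by positivity) (Real.sin_pos_of_pos_of_lt_pi (by linarith) (by linarith))
    · rw [hf0, hs', im_polar_div_polar hU]
      exact mul_neg_of_pos_of_neg (by positivity)
        (Real.sin_neg_of_neg_of_neg_pi_lt (by linarith) (by linarith))
  rw [hstart, hend]
  refine ⟨by ring, ?_, ?_⟩ <;> rw [abs_le] <;> constructor <;> linarith

end

/-! ### Developments -/

/-- A right angle `t` makes the path turn left by `t - π`, a left angle by `π - t`. -/
lemma edge_of_planeAngle_right {a o c : ℂ} {t : ℝ} (hao : a ≠ o) (h : planeAngle c o a = t) :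
    c - o = (‖c - o‖ / ‖o - a‖ : ℝ) * Complex.exp ((t - Real.pi : ℝ) * Complex.I) * (o - a) := by
  have h1 := exp_argIoc ((c - o) / (a - o))
  change _ * Complex.exp (planeAngle c o a * Complex.I) = _ at h1
  have hne : a - o ≠ 0 := sub_ne_zero.2 hao
  rw [h, eq_div_iff hne, norm_div] at h1
  have e : Complex.exp ((t - Real.pi : ℝ) * Complex.I) = -Complex.exp (t * Complex.I) := by
    push_cast
    rw [sub_mul, Complex.exp_sub, Complex.exp_pi_mul_I, div_neg, div_one]
  rw [e, norm_sub_rev o a]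
  conv_lhs => rw [← h1]
  push_cast
  ring

lemma edge_of_planeAngle_left {a o c : ℂ} {t : ℝ} (hao : a ≠ o) (hco : c ≠ o)
    (h : planeAngle a o c = t) :
    c - o = (‖c - o‖ / ‖o - a‖ : ℝ) * Complex.exp ((Real.pi - t : ℝ) * Complex.I) * (o - a) := by
  have h1 := exp_argIoc ((a - o) / (c - o))
  change _ * Complex.exp (planeAngle a o c * Complex.I) = _ at h1
  have hne : c - o ≠ 0 := sub_ne_zero.2 hco
  have hna : (‖a - o‖ : ℂ) ≠ 0 :=
    Complex.ofReal_ne_zero.2 (norm_ne_zero_iff.2 (sub_ne_zero.2 hao))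
  have hnc : (‖c - o‖ : ℂ) ≠ 0 := Complex.ofReal_ne_zero.2 (norm_ne_zero_iff.2 hne)
  rw [h, eq_div_iff hne, norm_div] at h1
  have e : Complex.exp ((Real.pi - t : ℝ) * Complex.I) * Complex.exp (t * Complex.I) = -1 := by
    rw [← Complex.exp_add, ← Complex.exp_pi_mul_I]
    congr 1
    push_cast
    ring
  have e2 : o - a = -(a - o) := by ring
  rw [norm_sub_rev o a, e2]
  push_cast at h1 e ⊢
  have hxy : ((‖c - o‖ : ℂ) / ‖a - o‖) * (‖a - o‖ / ‖c - o‖) = 1 := by field_simp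
  linear_combination
    (-((‖c - o‖ : ℂ) / ‖a - o‖) * Complex.exp ((Real.pi - t) * Complex.I)) * h1
      + (c - o) * ((‖c - o‖ : ℂ) / ‖a - o‖) * (‖a - o‖ / ‖c - o‖) * e - (c - o) * hxy

/-- A path in the plane with `2 * k` edges, opposite edges being equally long, that is nearly
straight except for a nearly full left turn in the middle. -/
lemma exists_polar_of_turns {k : ℕ} (hk : 0 < k) {g : ℕ → ℂ} {L τ : ℕ → ℝ} {ε : ℝ}
    (hL : ∀ i < 2 * k, 0 < L i) (hLsymm : ∀ i < k, L (2 * k - 1 - i) = L i)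
    (hg : ∀ i < 2 * k, ‖g (i + 1) - g i‖ = L i)
    (hτ : ∀ i, i + 1 < 2 * k → g (i + 2) - g (i + 1)
      = (L (i + 1) / L i : ℝ) * Complex.exp (τ i * Complex.I) * (g (i + 1) - g i))
    (hτ₀ : 0 < Real.pi + τ (k - 1) ∧ Real.pi + τ (k - 1) < ε)
    (hτ₁ : ∀ i, i + 1 < k → |τ i| < ε ∧ |τ (2 * k - 2 - i)| < ε ∧ 0 ≤ τ i + τ (2 * k - 2 - i)) :
    ∃ (U : ℂ) (φ δ : ℕ → ℝ), ‖U‖ = 1 ∧ (∀ i < k, |φ i| ≤ 2 * k * ε) ∧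
      (∀ i < k, 0 < δ i ∧ δ i ≤ 2 * k * ε) ∧
      (∀ i < k, g (i + 1) - g i = polar U (L i) (φ i)) ∧
      (∀ i < k, g (2 * k - i) - g (2 * k - i - 1) = -polar U (L i) (φ i + δ i)) := by
  have hε : 0 < ε := hτ₀.1.trans hτ₀.2
  have hL0 := hL 0 (by omega)
  set Φ : ℕ → ℝ := fun i => ∑ j ∈ Finset.range i, τ j with hΦ
  have hΦs : ∀ i, Φ (i + 1) = Φ i + τ i := fun i => Finset.sum_range_succ _ _
  set U : ℂ := (g 1 - g 0) / L 0 with hUdef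
  have hedge : ∀ i < 2 * k, g (i + 1) - g i = polar U (L i) (Φ i) := by
    intro i
    induction i with
    | zero =>
      intro _
      have : (L 0 : ℂ) ≠ 0 := Complex.ofReal_ne_zero.2 hL0.ne'
      simp only [polar, hΦ, hUdef, Finset.range_zero, Finset.sum_empty]
      simp [mul_div_cancel₀ _ this]
    | succ i ih =>
      intro hi
      have : (L i : ℂ) ≠ 0 := Complex.ofReal_ne_zero.2 (hL i (by omega)).ne'
      rw [hτ i hi, ih (by omega), hΦs]
      simp only [polar]
      push_cast
      rw [add_mul, Complex.exp_add]
      field_simp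
  -- `Φ i` is the total turn before edge `i`; `δ i` is the turn from edge `i` to its opposite, in
  -- excess of the reversal `-π`.
  refine ⟨U, Φ, fun i => Φ (2 * k - 1 - i) - Φ i + Real.pi, ?_, ?_, ?_, ?_, ?_⟩
  · rw [hUdef, norm_div, hg 0 (by omega), Complex.norm_real, Real.norm_of_nonneg hL0.le,
      div_self hL0.ne']
  · have h : ∀ i < k, |Φ i| ≤ i * ε := by
      intro i
      induction i with
      | zero => intro _; simp [hΦ]
      | succ i ih =>
        intro hi
        rw [hΦs]
        refine (abs_add_le _ _).trans ?_
        push_cast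
        linarith [ih (by omega), (hτ₁ i hi).1]
    intro i hi
    refine (h i hi).trans (mul_le_mul_of_nonneg_right ?_ hε.le)
    have : (i : ℝ) ≤ 2 * k := by exact_mod_cast (by omega : i ≤ 2 * k)
    exact this
  · have h : ∀ n < k, 0 < Φ (2 * k - 1 - (k - 1 - n)) - Φ (k - 1 - n) + Real.pi ∧
        Φ (2 * k - 1 - (k - 1 - n)) - Φ (k - 1 - n) + Real.pi ≤ (2 * n + 1) * ε := by
      intro n
      induction n with
      | zero =>
        intro _
        have e1 : 2 * k - 1 - (k - 1 - 0) = k - 1 + 1 := by omega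
        rw [e1, hΦs, Nat.sub_zero, Nat.cast_zero]
        constructor <;> linarith [hτ₀.1, hτ₀.2]
      | succ n ih =>
        intro hn
        obtain ⟨h1, h2⟩ := ih (by omega)
        obtain ⟨h3, h4, h5⟩ := hτ₁ (k - 1 - (n + 1)) (by omega)
        have e1 : k - 1 - n = k - 1 - (n + 1) + 1 := by omega
        have e2 : 2 * k - 1 - (k - 1 - n) = 2 * k - 2 - (k - 1 - (n + 1)) := by omega
        have e3 : 2 * k - 1 - (k - 1 - (n + 1)) = 2 * k - 2 - (k - 1 - (n + 1)) + 1 := by omega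
        rw [e2, e1, hΦs] at h1 h2
        rw [e3, hΦs]
        push_cast
        constructor <;> linarith [(abs_lt.1 h3).2, (abs_lt.1 h4).2]
    intro i hi
    have e : k - 1 - (k - 1 - i) = i := by omega
    have := h (k - 1 - i) (by omega)
    rw [e] at this
    refine ⟨this.1, this.2.trans (mul_le_mul_of_nonneg_right ?_ hε.le)⟩
    have h2 : 2 * (k - 1 - i) + 1 ≤ 2 * k := by omega
    exact_mod_cast h2
  · intro i hi
    exact hedge i (by omega)
  · intro i hi
    have e1 : 2 * k - i = 2 * k - 1 - i + 1 := by omega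
    have e2 : 2 * k - i - 1 = 2 * k - 1 - i := by omega
    have e3 : Φ i + (Φ (2 * k - 1 - i) - Φ i + Real.pi) = Φ (2 * k - 1 - i) + Real.pi := by ring
    rw [e2, e1, hedge _ (by omega), e3, polar_add_pi, neg_neg, hLsymm i hi]

lemma doubling_of_le {k i : ℕ} {γ : ℕ → E3} (h : i ≤ k) : doubling k γ i = γ i := if_pos h

lemma doubling_of_ge {k i : ℕ} {γ : ℕ → E3} (h : k ≤ i) : doubling k γ i = γ (2 * k - i) := by
  rcases eq_or_lt_of_le h with rfl | h
  · rw [doubling_of_le le_rfl]; congr 1; omega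
  · exact if_neg (by omega)

/-- The developments of the stretched doubling are nearly straight, except in the middle. -/
lemma eventually_exists_polar (V : Finset E3) (hV : (interior (body V)).Nonempty) (t b : E3)
    (ht : IsTop V t) (hb : IsBottom V b) (k : ℕ) (γ : ℕ → E3) (hγ : IsPathIn V k γ)
    (hmono : IsMonotonePath k γ) (hvertex : IsVertex V (γ k)) (hkt : γ k ≠ t) (hkb : γ k ≠ b)
    (l : ℕ) (hl : l < k) {η : ℝ} (hη : 0 < η) :
    ∀ᶠ s : ℝ in Filter.atTop, ∀ g : ℕ → ℂ, IsDevelopmentOfStretchedDoubling V k γ l s g →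
      ∃ (U : ℂ) (L φ δ : ℕ → ℝ), ‖U‖ = 1 ∧ (∀ i < k, 0 < L i) ∧ (∀ i < k, |φ i| ≤ η) ∧
        (∀ i < k, 0 < δ i ∧ δ i ≤ η) ∧
        (∀ i < k, g (i + 1) - g i = polar U (L i) (φ i)) ∧
        (∀ i < k, g (2 * k - i) - g (2 * k - i - 1) = -polar U (L i) (φ i + δ i)) := by
  have hk : 0 < k := by omega
  have hkR : (0 : ℝ) < k := by exact_mod_cast hk
  set ε : ℝ := η / (2 * k) with hεdef
  have hε : 0 < ε := by positivity
  have hεk : 2 * k * ε = η := by rw [hεdef]; field_simp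
  have hnext : ∀ i < k, γ (i + 1) ∈ star V (γ i) := fun i hi => (hγ i hi).2
  have hprev : ∀ i < k, γ i ∈ star V (γ (i + 1)) := fun i hi => by
    change segment ℝ _ _ ⊆ _
    rw [segment_symm]; exact (hγ i hi).2
  have hinner : ∀ i ∈ Finset.range (k - 1), ∀ᶠ s : ℝ in Filter.atTop, _ := fun i hi =>
    eventually_surfaceAngle_stretch hV (o := γ (i + 1)) (a := γ i) (b := γ (i + 2))
      (hprev i (by have := Finset.mem_range.1 hi; omega))
      (hnext (i + 1) (by have := Finset.mem_range.1 hi; omega))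
      (by
        have hi := Finset.mem_range.1 hi
        rcases hmono with h | h
        · have h1 := h i (by omega)
          have h2 := h (i + 1) (by omega)
          exact mul_neg_of_neg_of_pos (by linarith) (by linarith)
        · have h1 := h i (by omega)
          have h2 := h (i + 1) (by omega)
          exact mul_neg_of_pos_of_neg (by linarith) (by linarith)) hε
  have hlast : k - 1 + 1 = k := by omega
  have htip := eventually_surfaceAngle_stretch_self hV ht hb hvertex hkt hkb (a := γ (k - 1))
    (by have := hprev (k - 1) (by omega); rwa [hlast] at this)
    (by
      rcases hmono with h | h
      · have := h (k - 1) (by omega); rw [hlast] at this; exact this.ne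
      · have := h (k - 1) (by omega); rw [hlast] at this; exact this.ne') hε
  filter_upwards [(Filter.eventually_all_finset _).2 hinner, htip, Filter.eventually_gt_atTop 0]
    with s hinner htip hs g hg
  obtain ⟨hlen, hright, hleft⟩ := hg
  set d : ℕ → E3 := fun i => stretch s (doubling k γ i) with hd
  have hd1 : ∀ i ≤ k, d i = stretch s (γ i) := fun i hi => by rw [hd]; simp [doubling_of_le hi]
  have hd2 : ∀ i, k ≤ i → d i = stretch s (γ (2 * k - i)) := fun i hi => by
    rw [hd]; simp [doubling_of_ge hi]
  have hdist : ∀ i < k, 0 < dist (d i) (d (i + 1)) := fun i hi => by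
    rw [hd1 i hi.le, hd1 (i + 1) hi]
    exact dist_pos.2 fun h => (hγ i hi).1 (stretch_injective hs.ne' h)
  have hsymm : ∀ i < k, dist (d (2 * k - 1 - i)) (d (2 * k - 1 - i + 1)) = dist (d i) (d (i + 1)) := by
    intro i hi
    rw [hd2 _ (by omega), hd2 _ (by omega), hd1 i hi.le, hd1 (i + 1) hi, dist_comm]
    congr 3 <;> omega
  have hpos : ∀ i < 2 * k, 0 < dist (d i) (d (i + 1)) := by
    intro i hi
    by_cases h : i < k
    · exact hdist i h
    · have e : 2 * k - 1 - (2 * k - 1 - i) = i := by omega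
      have := hsymm (2 * k - 1 - i) (by omega)
      rw [e] at this
      rw [this]
      exact hdist _ (by omega)
  have hnorm : ∀ i < 2 * k, ‖g (i + 1) - g i‖ = dist (d i) (d (i + 1)) := fun i hi => by
    rw [← hlen i hi, dist_comm, dist_eq_norm]
  have hne : ∀ i < 2 * k, g i ≠ g (i + 1) := fun i hi h => by
    have := hnorm i hi
    rw [h, sub_self, norm_zero] at this
    exact (hpos i hi).ne this
  set W := stretchPoints s V
  -- The left turn at vertex `i + 1`, read off from whichever angle the mixed development keeps
  -- there.
  set τ : ℕ → ℝ := fun i => if i + 1 ≤ l then surfaceAngle W (d (i + 2)) (d (i + 1)) (d i) - Real.pi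
    else Real.pi - surfaceAngle W (d i) (d (i + 1)) (d (i + 2)) with hτ
  obtain ⟨U, φ, δ, h1, h2, h3, h4, h5⟩ := exists_polar_of_turns hk (g := g) (ε := ε)
    (L := fun i => dist (d i) (d (i + 1))) (τ := τ) hpos hsymm hnorm
    (by
      intro i hi
      simp only [← hnorm (i + 1) hi, ← hnorm i (by omega)]
      by_cases h : i + 1 ≤ l
      · have : τ i = surfaceAngle W (d (i + 2)) (d (i + 1)) (d i) - Real.pi := if_pos h
        rw [this]
        exact edge_of_planeAngle_right (hne i (by omega)) (hright i hi h)
      · have : τ i = Real.pi - surfaceAngle W (d i) (d (i + 1)) (d (i + 2)) := if_neg h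
        rw [this]
        exact edge_of_planeAngle_left (hne i (by omega)) (hne (i + 1) hi).symm
          (hleft i hi (by omega)))
    (by
      have : τ (k - 1) = Real.pi - surfaceAngle W (d (k - 1)) (d (k - 1 + 1)) (d (k - 1 + 2)) :=
        if_neg (by omega)
      have e : 2 * k - (k - 1 + 2) = k - 1 := by omega
      rw [this, hd1 _ (by omega), hd1 _ (by omega), hd2 _ (by omega), hlast, e]
      constructor <;> linarith [htip.1, htip.2])
    (by
      intro i hi
      obtain ⟨k1, k2, k3⟩ := hinner i (Finset.mem_range.2 (by omega))
      -- As `l < k`, left angles are kept on the whole way back; traversed backwards, these are the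
      -- right angles of the way out.
      have h0 : τ (2 * k - 2 - i) = Real.pi - surfaceAngle W (stretch s (γ (i + 2)))
          (stretch s (γ (i + 1))) (stretch s (γ i)) := by
        have : τ (2 * k - 2 - i) = Real.pi - surfaceAngle W (d (2 * k - 2 - i))
          (d (2 * k - 2 - i + 1)) (d (2 * k - 2 - i + 2)) := if_neg (by omega)
        have e0 : 2 * k - (2 * k - 2 - i) = i + 2 := by omega
        have e1 : 2 * k - (2 * k - 2 - i + 1) = i + 1 := by omega
        have e2 : 2 * k - (2 * k - 2 - i + 2) = i := by omega
        rw [this, hd2 _ (by omega), hd2 _ (by omega), hd2 _ (by omega), e0, e1, e2]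
      rw [h0]
      -- In the first case the two turns cancel exactly; in the second they add up to `2π` minus the
      -- sum of the two angles.
      by_cases h : i + 1 ≤ l
      · have : τ i = surfaceAngle W (stretch s (γ (i + 2))) (stretch s (γ (i + 1)))
            (stretch s (γ i)) - Real.pi := by
          rw [← hd1 i (by omega), ← hd1 (i + 1) (by omega), ← hd1 (i + 2) (by omega)]
          exact if_pos h
        rw [this]
        refine ⟨k3, ?_, by linarith⟩
        rw [abs_sub_comm]; exact k3
      · have : τ i = Real.pi - surfaceAngle W (stretch s (γ i)) (stretch s (γ (i + 1)))
            (stretch s (γ (i + 2))) := by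
          rw [← hd1 i (by omega), ← hd1 (i + 1) (by omega), ← hd1 (i + 2) (by omega)]
          exact if_neg h
        rw [this]
        refine ⟨?_, ?_, by linarith⟩
        · rw [abs_sub_comm]; exact k2
        · rw [abs_sub_comm]; exact k3)
  rw [hεk] at h2 h3
  exact ⟨U, _, φ, δ, h1, fun i hi => hpos i (by omega), h2, h3, h4, h5⟩

end StretchedPaths

theorem proposition7p6
    (V : Finset StretchedPaths.E3)
    (hV : (interior (StretchedPaths.body V)).Nonempty)
    (t b : StretchedPaths.E3)
    (ht : StretchedPaths.IsTop V t) (hb : StretchedPaths.IsBottom V b)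
    (k : ℕ) (γ : ℕ → StretchedPaths.E3)
    (hγ : StretchedPaths.IsPathIn V k γ)
    (hmono : StretchedPaths.IsMonotonePath k γ)
    (hvertex : StretchedPaths.IsVertex V (γ k)) (hkt : γ k ≠ t) (hkb : γ k ≠ b)
    (l : ℕ) (hl : l < k) :
    (∀ᶠ s : ℝ in Filter.atTop, ∀ g : ℕ → ℂ,
      StretchedPaths.IsDevelopmentOfStretchedDoubling V k γ l s g →
        StretchedPaths.IsSimplePath (2 * k) g ∧
        g 0 ≠ g (2 * k) ∧
        (line[ℝ, g 0, g (2 * k)] : Set ℂ) ∩ StretchedPaths.trace (2 * k) g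
          = {g 0, g (2 * k)} ∧
        StretchedPaths.startAngle (2 * k) g + StretchedPaths.endAngle (2 * k) g < Real.pi) ∧
    (∀ ε > 0, ∀ᶠ s : ℝ in Filter.atTop, ∀ g : ℕ → ℂ,
      StretchedPaths.IsDevelopmentOfStretchedDoubling V k γ l s g →
        |StretchedPaths.startAngle (2 * k) g - Real.pi / 2| < ε ∧
        |StretchedPaths.endAngle (2 * k) g - Real.pi / 2| < ε) := by
  have key := fun {η : ℝ} (hη : 0 < η) =>
    StretchedPaths.eventually_exists_polar V hV t b ht hb k γ hγ hmono hvertex hkt hkb l hl hη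
  have hk : 0 < k := by omega
  constructor
  · filter_upwards [key (show (0 : ℝ) < 1 / 4 by norm_num)] with s hs g hg
    obtain ⟨U, L, φ, δ, hU, hL, hφ, hδ, he, hr⟩ := hs g hg
    have hH := StretchedPaths.isHairpin_of_polar hU hk le_rfl hL hφ hδ he hr
    refine ⟨hH.isSimplePath, hH.start_ne_end, hH.line_inter_trace, ?_⟩
    have := (StretchedPaths.angles_of_polar hU hk le_rfl hL hφ hδ he hr).1
    linarith [(hδ 0 hk).1]
  · intro ε hε
    -- The base angles deviate from `π / 2` by at most `4 * η ≤ 4 * ε / 5 < ε`.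
    have hη : 0 < min (1 / 4) (ε / 5) := lt_min (by norm_num) (by linarith)
    filter_upwards [key hη] with s hs g hg
    obtain ⟨U, L, φ, δ, hU, hL, hφ, hδ, he, hr⟩ := hs g hg
    obtain ⟨_, h1, h2⟩ :=
      StretchedPaths.angles_of_polar hU hk (min_le_left _ _) hL hφ hδ he hr
    have h3 := min_le_right (1 / 4) (ε / 5)
    constructor <;> linarith
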